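/- Let $\mathsf k$ be an algebraically closed field of characteristic zero, let $D$ be the polynomial algebra $\mathsf k[h]$ or the Laurent polynomial algebra $\mathsf k[h^{\pm 1}]$, let $0 \neq a \in D$, and let $\sigma$ be a $\mathsf k$-algebra automorphism of $D$. For $n \ge 0$ put $D^n = D^{\otimes n}$ (tensor product over $\mathsf k$), $a_i = 1 \otimes \cdots \otimes a \otimes \cdots \otimes 1$ and $\sigma_i = \mathrm{id} \otimes \cdots \otimes \sigma \otimes \cdots \otimes \mathrm{id}$ ($a$, respectively $\sigma$, in position $i$), $1 \le i \le n$. Let $D^n(a^n,\sigma^n)$ be the generalized Weyl algebra generated over $D^n$ by $X_1^\pm, \ldots, X_n^\pm$ with the relations $X_i^+ d = \sigma_i(d) X_i^+$ and $X_i^- d = \sigma_i^{-1}(d) X_i^-$ for $d \in D^n$, $[X_i^+,X_j^+] = [X_i^-,X_j^-] = [X_i^+,X_j^-] = 0$ for $i \ne j$, $X_i^- X_i^+ = a_i$ and $X_i^+ X_i^- = \sigma_i(a_i)$. Let $m \ge 1$ and $p \mid m$, let $A(m,p,n)$ be the group of $n$-tuples $(\zeta_1, \ldots, \zeta_n)$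 of $m$-th roots of unity in $\mathsf k$ with $(\prod_i \zeta_i)^{m/p} = 1$, and let $G(m,p,n) = A(m,p,n) \rtimes S_n$, where $S_n$ permutes the entries. This group acts on $D^n(a^n,\sigma^n)$ by algebra automorphisms: $(\zeta_1, \ldots, \zeta_n) \in A(m,p,n)$ fixes $D^n$ and sends $X_i^{\pm}$ to $\zeta_i^{\pm 1} X_i^{\pm}$, and $\pi \in S_n$ permutes the tensor factors of $D^n$, moving the factor in position $i$ to position $\pi(i)$, and sends $X_i^\pm$ to $X_{\pi(i)}^\pm$. Let $D^* = (D^n)^{S_n}$. Then the natural map $D^* \to D^n(a^n,\sigma^n)^{G(m,p,n)}$ is injective; its image, identified with $D^*$, is a Harish-Chandra subalgebra of $U = D^n(a^n,\sigma^n)^{G(m,p,n)}$, that is, for every $u \in U$ the bimodule $D^* u D^*$ is finitely generated as a left and as a right $D^*$-module, and $\operatorname{Ext}^1_{D^*}(S_{\mathfrak m}, S_{\mathfrak n}) = 0$ for any two distinct maximal ideals $\mathfrak m, \mathfrak n$ of $D^*$ of finite codimension, where $S_{\mathfrak m}$ denotes the simple module $D^*/\mathfrak m$; and $U$ is a free left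 $D^*$-module and a free right $D^*$-module. -/

import Mathlib

noncomputable section

namespace GenWeyl

universe u v w

/-! ### Fixed subalgebras -/

section Fixed

variable {k : Type u} {A : Type v} {G : Type w} [CommSemiring k] [Semiring A] [Algebra k A]
  [Monoid G]

/-- The subalgebra `A ^ G` of elements fixed by an action of `G` on `A` by algebra maps. -/
def fixedSubalgebra (ρ : G →* (A →ₐ[k] A)) : Subalgebra k A where
  carrier := {x | ∀ g, ρ g x = x}
  mul_mem' hx hy g := by rw [map_mul, hx g, hy g]
  add_mem' hx hy g := by rw [map_add, hx g, hy g]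
  algebraMap_mem' r g := by rw [AlgHom.commutes]

end Fixed

/-! ### Harish-Chandra subalgebras -/

section HarishChandra

open CategoryTheory

variable {k : Type u} [Field k]

/-- `Γ` is quasi-central in `U`: for every `u`, the bimodule `Γ u Γ` is finitely generated as a left
and as a right `Γ`-module. It is the left `Γ`-span of `u Γ`, and the right `Γ`-span of `Γ u`. -/
def IsQuasiCentral {U : Type v} [Ring U] [Algebra k U] (Γ : Subalgebra k U) : Prop :=
  ∀ u : U,
    (Submodule.span Γ (Set.range fun δ : Γ => u * (δ : U))).FG ∧
    (Submodule.span Γ.op (Set.range fun γ : Γ => (γ : U) * u)).FG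

/-- The cofinite spectrum: maximal two-sided ideals of finite codimension. -/
def cofiniteSpectrum (k : Type u) [Field k] (Γ : Type v) [Ring Γ] [Algebra k Γ] :
    Set (TwoSidedIdeal Γ) :=
  {I | IsCoatom I ∧ Module.Finite k I.ringCon.Quotient}

/-- `S` is a simple module of the quotient of `Γ` by `I`, viewed as a `Γ`-module. For `I` in the
cofinite spectrum there is exactly one such `S` up to isomorphism. -/
def IsSimpleOver {Γ : Type v} [Ring Γ] (I : TwoSidedIdeal Γ) (S : ModuleCat.{v} Γ) : Prop :=
  IsSimpleModule Γ S ∧ ∀ x ∈ I, ∀ s : S, x • s = 0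

/-- `Γ` is quasi-commutative: there are no nontrivial extensions between the simple modules that
belong to distinct members of the cofinite spectrum. -/
def IsQuasiCommutative (k : Type u) [Field k] (Γ : Type v) [Ring Γ] [Algebra k Γ] : Prop :=
  ∀ I ∈ cofiniteSpectrum k Γ, ∀ J ∈ cofiniteSpectrum k Γ, I ≠ J →
    ∀ S T : ModuleCat.{v} Γ, IsSimpleOver I S → IsSimpleOver J T →
      Subsingleton (Abelian.Ext.{v} S T 1)

/-- A Harish-Chandra subalgebra is one that is quasi-central and quasi-commutative. -/
def IsHarishChandra {U : Type v} [Ring U] [Algebra k U] (Γ : Subalgebra k U) : Prop :=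
  IsQuasiCentral Γ ∧ IsQuasiCommutative k Γ

end HarishChandra

/-! ### Generalized Weyl algebras -/

section GWA

variable {k : Type u} {D : Type v} {ι : Type w} [CommRing k] [Ring D] [Algebra k D]

/-- Generators: a symbol for every `d : D`, and the symbols `X_i⁺` and `X_i⁻`. -/
inductive Gen (D : Type v) (ι : Type w) : Type (max v w)
  | base (d : D) : Gen D ι
  | plus (i : ι) : Gen D ι
  | minus (i : ι) : Gen D ι

/-- The symbol of `d : D` in the free algebra. -/
abbrev gB (d : D) : FreeAlgebra k (Gen D ι) := FreeAlgebra.ι k (Gen.base d)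

/-- The symbol of `X_i⁺` in the free algebra. -/
abbrev gP (i : ι) : FreeAlgebra k (Gen D ι) := FreeAlgebra.ι k (Gen.plus i)

/-- The symbol of `X_i⁻` in the free algebra. -/
abbrev gM (i : ι) : FreeAlgebra k (Gen D ι) := FreeAlgebra.ι k (Gen.minus i)

/-- The relations: `D` maps by an algebra homomorphism, and the relations of a generalized
Weyl algebra hold. -/
inductive Rel (a : ι → D) (σ : ι → (D ≃ₐ[k] D)) :
    FreeAlgebra k (Gen D ι) → FreeAlgebra k (Gen D ι) → Prop
  | base_add (d e : D) : Rel a σ (gB (d + e)) (gB d + gB e)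
  | base_mul (d e : D) : Rel a σ (gB (d * e)) (gB d * gB e)
  | base_algebraMap (r : k) : Rel a σ (gB (algebraMap k D r)) (algebraMap k _ r)
  | plus_base (i : ι) (d : D) : Rel a σ (gP i * gB d) (gB (σ i d) * gP i)
  | minus_base (i : ι) (d : D) : Rel a σ (gM i * gB d) (gB ((σ i).symm d) * gM i)
  | plus_plus (i j : ι) (h : i ≠ j) : Rel a σ (gP i * gP j) (gP j * gP i)
  | minus_minus (i j : ι) (h : i ≠ j) : Rel a σ (gM i * gM j) (gM j * gM i)
  | plus_minus_comm (i j : ι) (h : i ≠ j) : Rel a σ (gP i * gM j) (gM j * gP i)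
  | minus_plus (i : ι) : Rel a σ (gM i * gP i) (gB (a i))
  | plus_minus (i : ι) : Rel a σ (gP i * gM i) (gB (σ i (a i)))

/-- The algebra `D(a, σ)` generated over `D` by the `X_i⁺`, `X_i⁻` with the relations above. -/
def GWA (a : ι → D) (σ : ι → (D ≃ₐ[k] D)) : Type (max u v w) := RingQuot (Rel a σ)

namespace GWA

variable (a : ι → D) (σ : ι → (D ≃ₐ[k] D))

instance : Ring (GWA a σ) := inferInstanceAs (Ring (RingQuot (Rel a σ)))

instance : Algebra k (GWA a σ) := inferInstanceAs (Algebra k (RingQuot (Rel a σ)))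

/-- The quotient map from the free algebra. -/
def mk : FreeAlgebra k (Gen D ι) →ₐ[k] GWA a σ := RingQuot.mkAlgHom k (Rel a σ)

/-- The structure map `D → D(a, σ)`. -/
def ofBase : D →ₐ[k] GWA a σ where
  toFun d := mk a σ (gB d)
  map_one' := by
    have := RingQuot.mkAlgHom_rel k (Rel.base_algebraMap (a := a) (σ := σ) 1)
    simp only [map_one] at this
    exact this
  map_mul' d e := (RingQuot.mkAlgHom_rel k (Rel.base_mul (a := a) (σ := σ) d e)).trans
    (map_mul _ _ _)
  map_zero' := by
    have := RingQuot.mkAlgHom_rel k (Rel.base_algebraMap (a := a) (σ := σ) 0)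
    simp only [map_zero] at this
    exact this
  map_add' d e := (RingQuot.mkAlgHom_rel k (Rel.base_add (a := a) (σ := σ) d e)).trans
    (map_add _ _ _)
  commutes' r := (RingQuot.mkAlgHom_rel k (Rel.base_algebraMap (a := a) (σ := σ) r)).trans
    (AlgHom.commutes _ r)

/-- The generator `X_i⁺`. -/
def Xp (i : ι) : GWA a σ := mk a σ (gP i)

/-- The generator `X_i⁻`. -/
def Xm (i : ι) : GWA a σ := mk a σ (gM i)

variable {a σ}

theorem Xp_base (i : ι) (d : D) :
    Xp a σ i * ofBase a σ d = ofBase a σ (σ i d) * Xp a σ i := by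
  have := RingQuot.mkAlgHom_rel k (Rel.plus_base (a := a) (σ := σ) i d)
  rwa [map_mul, map_mul] at this

theorem Xm_base (i : ι) (d : D) :
    Xm a σ i * ofBase a σ d = ofBase a σ ((σ i).symm d) * Xm a σ i := by
  have := RingQuot.mkAlgHom_rel k (Rel.minus_base (a := a) (σ := σ) i d)
  rwa [map_mul, map_mul] at this

theorem Xp_Xp {i j : ι} (h : i ≠ j) : Xp a σ i * Xp a σ j = Xp a σ j * Xp a σ i := by
  have := RingQuot.mkAlgHom_rel k (Rel.plus_plus (a := a) (σ := σ) i j h)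
  rwa [map_mul, map_mul] at this

theorem Xm_Xm {i j : ι} (h : i ≠ j) : Xm a σ i * Xm a σ j = Xm a σ j * Xm a σ i := by
  have := RingQuot.mkAlgHom_rel k (Rel.minus_minus (a := a) (σ := σ) i j h)
  rwa [map_mul, map_mul] at this

theorem Xp_Xm {i j : ι} (h : i ≠ j) : Xp a σ i * Xm a σ j = Xm a σ j * Xp a σ i := by
  have := RingQuot.mkAlgHom_rel k (Rel.plus_minus_comm (a := a) (σ := σ) i j h)
  rwa [map_mul, map_mul] at this

theorem Xm_Xp_self (i : ι) : Xm a σ i * Xp a σ i = ofBase a σ (a i) := by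
  have := RingQuot.mkAlgHom_rel k (Rel.minus_plus (a := a) (σ := σ) i)
  rwa [map_mul] at this

theorem Xp_Xm_self (i : ι) : Xp a σ i * Xm a σ i = ofBase a σ (σ i (a i)) := by
  have := RingQuot.mkAlgHom_rel k (Rel.plus_minus (a := a) (σ := σ) i)
  rwa [map_mul] at this

section Lift

variable {B : Type*} [Ring B] [Algebra k B]

/-- The universal property of `D(a, σ)`. -/
def lift (f : D →ₐ[k] B) (y z : ι → B)
    (hy : ∀ i d, y i * f d = f (σ i d) * y i)
    (hz : ∀ i d, z i * f d = f ((σ i).symm d) * z i)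
    (hyy : ∀ i j, i ≠ j → y i * y j = y j * y i)
    (hzz : ∀ i j, i ≠ j → z i * z j = z j * z i)
    (hyz : ∀ i j, i ≠ j → y i * z j = z j * y i)
    (hzy : ∀ i, z i * y i = f (a i))
    (hyz' : ∀ i, y i * z i = f (σ i (a i))) : GWA a σ →ₐ[k] B :=
  RingQuot.liftAlgHom k ⟨FreeAlgebra.lift k fun
    | Gen.base d => f d
    | Gen.plus i => y i
    | Gen.minus i => z i, by
    intro s t h
    cases h <;> simp <;> grind⟩

variable {f : D →ₐ[k] B} {y z : ι → B}
  {hy : ∀ i d, y i * f d = f (σ i d) * y i}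
  {hz : ∀ i d, z i * f d = f ((σ i).symm d) * z i}
  {hyy : ∀ i j, i ≠ j → y i * y j = y j * y i}
  {hzz : ∀ i j, i ≠ j → z i * z j = z j * z i}
  {hyz : ∀ i j, i ≠ j → y i * z j = z j * y i}
  {hzy : ∀ i, z i * y i = f (a i)}
  {hyz' : ∀ i, y i * z i = f (σ i (a i))}

@[simp]
theorem lift_ofBase (d : D) : lift f y z hy hz hyy hzz hyz hzy hyz' (ofBase a σ d) = f d :=
  (RingQuot.liftAlgHom_mkAlgHom_apply _ _ _ _).trans (by simp)

@[simp]
theorem lift_Xp (i : ι) : lift f y z hy hz hyy hzz hyz hzy hyz' (Xp a σ i) = y i :=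
  (RingQuot.liftAlgHom_mkAlgHom_apply _ _ _ _).trans (by simp)

@[simp]
theorem lift_Xm (i : ι) : lift f y z hy hz hyy hzz hyz hzy hyz' (Xm a σ i) = z i :=
  (RingQuot.liftAlgHom_mkAlgHom_apply _ _ _ _).trans (by simp)

theorem hom_ext {g h : GWA a σ →ₐ[k] B} (h0 : ∀ d, g (ofBase a σ d) = h (ofBase a σ d))
    (hp : ∀ i, g (Xp a σ i) = h (Xp a σ i)) (hm : ∀ i, g (Xm a σ i) = h (Xm a σ i)) : g = h := by
  refine RingQuot.ringQuot_ext' k g h (FreeAlgebra.hom_ext (funext fun s => ?_))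
  cases s with
  | base d => exact h0 d
  | plus i => exact hp i
  | minus i => exact hm i

end Lift

end GWA

end GWA

/-! ### The base `D^{⊗ n}` and its symmetries -/

section Tensor

variable {k : Type u} {D : Type v} [CommRing k] [CommRing D] [Algebra k D] (n : ℕ)

/-- `D^n`, the `n`-fold tensor power of `D` over `k`. -/
abbrev TPow (k : Type u) (D : Type v) [CommRing k] [CommRing D] [Algebra k D] (n : ℕ) :
    Type (max u v) :=
  PiTensorProduct k fun _ : Fin n => D

variable {n}

/-- `d_1 ⊗ … ⊗ d_n ↦ f_1(d_1) ⊗ … ⊗ f_n(d_n)`. -/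
def tensorMap (f : Fin n → (D →ₐ[k] D)) : TPow k D n →ₐ[k] TPow k D n :=
  PiTensorProduct.liftAlgHom
    ((PiTensorProduct.tprod k).compLinearMap fun i => (f i).toLinearMap)
    (by simp [PiTensorProduct.one_def]; rfl)
    (fun x y => by simp [PiTensorProduct.tprod_mul_tprod]; rfl)

theorem tensorMap_tprod (f : Fin n → (D →ₐ[k] D)) (x : Fin n → D) :
    tensorMap f (PiTensorProduct.tprod k x) = PiTensorProduct.tprod k fun i => f i (x i) := by
  simp [tensorMap]

theorem tpow_hom_ext {B : Type*} [Semiring B] [Algebra k B] {f g : TPow k D n →ₐ[k] B}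
    (h : ∀ x : Fin n → D, f (PiTensorProduct.tprod k x) = g (PiTensorProduct.tprod k x)) :
    f = g :=
  AlgHom.toLinearMap_injective (PiTensorProduct.ext (MultilinearMap.ext h))

theorem tensorMap_comp_eq_id (f g : Fin n → (D →ₐ[k] D)) (h : ∀ i d, f i (g i d) = d) :
    (tensorMap f).comp (tensorMap g) = AlgHom.id k (TPow k D n) :=
  tpow_hom_ext fun x => by simp [tensorMap_tprod, h]

/-- `1 ⊗ … ⊗ d ⊗ … ⊗ 1`, with `d` in position `i`. -/
def elemAt (k : Type u) {D : Type v} [CommRing k] [CommRing D] [Algebra k D] {n : ℕ}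
    (d : D) (i : Fin n) : TPow k D n :=
  PiTensorProduct.tprod k (Function.update (fun _ => 1) i d)

/-- `id ⊗ … ⊗ σ ⊗ … ⊗ id`, with `σ` in position `i`. -/
def sigmaAt (σ : D ≃ₐ[k] D) (i : Fin n) : TPow k D n ≃ₐ[k] TPow k D n :=
  AlgEquiv.ofAlgHom
    (tensorMap (Function.update (fun _ => AlgHom.id k D) i (σ : D →ₐ[k] D)))
    (tensorMap (Function.update (fun _ => AlgHom.id k D) i (σ.symm : D →ₐ[k] D)))
    (tensorMap_comp_eq_id _ _ fun j d => by
      rcases eq_or_ne j i with rfl | h <;> simp [*])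
    (tensorMap_comp_eq_id _ _ fun j d => by
      rcases eq_or_ne j i with rfl | h <;> simp [*])

theorem sigmaAt_tprod (σ : D ≃ₐ[k] D) (i : Fin n) (x : Fin n → D) :
    sigmaAt σ i (PiTensorProduct.tprod k x) =
      PiTensorProduct.tprod k (Function.update x i (σ (x i))) := by
  refine (tensorMap_tprod _ _).trans (congrArg _ (funext fun j => ?_))
  rcases eq_or_ne j i with rfl | h <;> simp [*]

/-- The permutation `π` moves the tensor factor in position `i` to position `π i`. -/
def tensorPerm (π : Equiv.Perm (Fin n)) : TPow k D n →ₐ[k] TPow k D n :=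
  PiTensorProduct.liftAlgHom ((PiTensorProduct.tprod k).domDomCongr π⁻¹)
    (by simp [PiTensorProduct.one_def]; rfl)
    (fun x y => by simp [PiTensorProduct.tprod_mul_tprod]; rfl)

theorem tensorPerm_tprod (π : Equiv.Perm (Fin n)) (x : Fin n → D) :
    tensorPerm π (PiTensorProduct.tprod k x) = PiTensorProduct.tprod k fun i => x (π⁻¹ i) := by
  simp [tensorPerm]

theorem tensorPerm_elemAt (π : Equiv.Perm (Fin n)) (d : D) (i : Fin n) :
    tensorPerm π (elemAt k d i) = elemAt k d (π i) := by
  refine (tensorPerm_tprod _ _).trans (congrArg _ (funext fun j => ?_))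
  rcases eq_or_ne j (π i) with rfl | h
  · simp
  · have h' : π⁻¹ j ≠ i := fun e => h (by simp [← e])
    rw [Function.update_of_ne h, Function.update_of_ne h']

theorem tensorPerm_sigmaAt (π : Equiv.Perm (Fin n)) (σ : D ≃ₐ[k] D) (i : Fin n)
    (x : TPow k D n) :
    tensorPerm π (sigmaAt σ i x) = sigmaAt σ (π i) (tensorPerm π x) := by
  have : (tensorPerm π).comp (sigmaAt σ i : TPow k D n →ₐ[k] TPow k D n) =
      (sigmaAt σ (π i) : TPow k D n →ₐ[k] TPow k D n).comp (tensorPerm π) :=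
    tpow_hom_ext fun x => by
      simp only [AlgHom.comp_apply, AlgEquiv.coe_toAlgHom, sigmaAt_tprod, tensorPerm_tprod]
      refine congrArg _ (funext fun j => ?_)
      rcases eq_or_ne j (π i) with rfl | h
      · simp
      · have h' : π⁻¹ j ≠ i := fun e => h (by simp [← e])
        rw [Function.update_of_ne h, Function.update_of_ne h']
  exact DFunLike.congr_fun this x

theorem tensorPerm_sigmaAt_symm (π : Equiv.Perm (Fin n)) (σ : D ≃ₐ[k] D) (i : Fin n)
    (x : TPow k D n) :
    tensorPerm π ((sigmaAt σ i).symm x) = (sigmaAt σ (π i)).symm (tensorPerm π x) := by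
  rw [AlgEquiv.eq_symm_apply, ← tensorPerm_sigmaAt, AlgEquiv.apply_symm_apply]

/-- The action of the symmetric group on `D^n` by permutation of the tensor factors. -/
def permAction (k : Type u) (D : Type v) [CommRing k] [CommRing D] [Algebra k D] (n : ℕ) :
    Equiv.Perm (Fin n) →* (TPow k D n →ₐ[k] TPow k D n) where
  toFun := tensorPerm
  map_one' := tpow_hom_ext fun x => by simp [tensorPerm_tprod]
  map_mul' π τ := tpow_hom_ext fun x => by simp [tensorPerm_tprod]

/-- `D^* = (D^n)^{S_n}`. -/
abbrev DStar (k : Type u) (D : Type v) [CommRing k] [CommRing D] [Algebra k D] (n : ℕ) :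
    Subalgebra k (TPow k D n) :=
  fixedSubalgebra (permAction k D n)

end Tensor

/-! ### The groups `G(m, p, n)` -/

section Group

/-- `A(m, p, n)`: the `n`-tuples of `m`-th roots of unity with `(∏ ζ_i) ^ (m / p) = 1`. -/
def diagGroup (k : Type u) [Field k] (m p n : ℕ) : Subgroup (Fin n → rootsOfUnity m k) where
  carrier := {ζ | (∏ i, ζ i) ^ (m / p) = 1}
  mul_mem' {ζ η} hζ hη := by
    simp only [Set.mem_ofPred_eq, Pi.mul_apply, Finset.prod_mul_distrib, mul_pow] at *
    rw [hζ, hη, one_mul]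
  one_mem' := by simp
  inv_mem' {ζ} hζ := by
    simp only [Set.mem_ofPred_eq, Pi.inv_apply, Finset.prod_inv_distrib, inv_pow] at *
    rw [hζ, inv_one]

/-- The symmetric group permutes the entries of the elements of `A(m, p, n)`. -/
def permEntries (k : Type u) [Field k] (m p n : ℕ) :
    Equiv.Perm (Fin n) →* MulAut (diagGroup k m p n) where
  toFun π :=
    { toFun := fun ζ => ⟨fun i => ζ.1 (π⁻¹ i), by
        have h : (∏ i, ζ.1 i) ^ (m / p) = 1 := ζ.2
        change (∏ i, ζ.1 (π⁻¹ i)) ^ (m / p) = 1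
        rwa [Equiv.prod_comp π⁻¹ ζ.1]⟩
      invFun := fun ζ => ⟨fun i => ζ.1 (π i), by
        have h : (∏ i, ζ.1 i) ^ (m / p) = 1 := ζ.2
        change (∏ i, ζ.1 (π i)) ^ (m / p) = 1
        rwa [Equiv.prod_comp π ζ.1]⟩
      left_inv := fun ζ => by ext; simp
      right_inv := fun ζ => by ext; simp
      map_mul' := fun ζ η => rfl }
  map_one' := by ext; rfl
  map_mul' π τ := by ext; simp

/-- `G(m, p, n) = A(m, p, n) ⋊ S_n`. -/
abbrev ShephardTodd (k : Type u) [Field k] (m p n : ℕ) : Type u :=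
  diagGroup k m p n ⋊[permEntries k m p n] Equiv.Perm (Fin n)

end Group

/-! ### The action on the generalized Weyl algebra `D^n(a^n, σ^n)` -/

section Action

variable {k : Type u} {D : Type v} [Field k] [CommRing D] [Algebra k D]

/-- `D^n(a^n, σ^n)`, where `a^n` and `σ^n` have the `i`-th entries `1 ⊗ … ⊗ a ⊗ … ⊗ 1` and
`id ⊗ … ⊗ σ ⊗ … ⊗ id`. -/
abbrev TGWA (a : D) (σ : D ≃ₐ[k] D) (n : ℕ) : Type (max u v) :=
  GWA (k := k) (D := TPow k D n) (ι := Fin n) (elemAt k a) (sigmaAt σ)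

variable (a : D) (σ : D ≃ₐ[k] D) (n : ℕ)

/-- For a tuple of units `ζ` and a permutation `π`, the endomorphism of `D^n(a^n, σ^n)` that
is `π` on `D^n` and sends `X_i^±` to `ζ_{π i}^{±1} X_{π i}^±`: the permutation of the indices
by `π`, followed by the scaling of `X_i^±` by `ζ_i^{±1}`. -/
def monomialHom (ζ : Fin n → kˣ) (π : Equiv.Perm (Fin n)) : TGWA a σ n →ₐ[k] TGWA a σ n :=
  GWA.lift ((GWA.ofBase _ _).comp (tensorPerm π))
    (fun i => (ζ (π i) : k) • GWA.Xp _ _ (π i))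
    (fun i => ((ζ (π i))⁻¹ : kˣ).val • GWA.Xm _ _ (π i))
    (fun i d => by simp [tensorPerm_sigmaAt, GWA.Xp_base])
    (fun i d => by simp [tensorPerm_sigmaAt_symm, GWA.Xm_base])
    (fun i j h => by
      simp only [smul_mul_smul_comm, GWA.Xp_Xp (π.injective.ne h), mul_comm (ζ (π i) : k)])
    (fun i j h => by
      simp only [smul_mul_smul_comm, GWA.Xm_Xm (π.injective.ne h),
        mul_comm ((ζ (π i))⁻¹ : kˣ).val])
    (fun i j h => by
      simp only [smul_mul_smul_comm, GWA.Xp_Xm (π.injective.ne h), mul_comm (ζ (π i) : k)])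
    (fun i => by simp [GWA.Xm_Xp_self, tensorPerm_elemAt])
    (fun i => by
      simp [GWA.Xp_Xm_self, tensorPerm_elemAt, tensorPerm_sigmaAt])

/-- The action of `G(m, p, n)` on `D^n(a^n, σ^n)`. -/
def groupAction (m p : ℕ) : ShephardTodd k m p n →* (TGWA a σ n →ₐ[k] TGWA a σ n) where
  toFun g := monomialHom a σ n (fun i => (g.left.1 i : kˣ)) g.right
  map_one' := by
    apply GWA.hom_ext <;> intro x
    · simp [monomialHom, show tensorPerm (k := k) (D := D) (1 : Equiv.Perm (Fin n)) = 1 from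
        map_one (permAction k D n)]
    · simp [monomialHom]
    · simp [monomialHom]
  map_mul' g h := by
    apply GWA.hom_ext <;> intro x
    · simp [monomialHom, show tensorPerm (k := k) (D := D) (g.right * h.right) =
        tensorPerm g.right * tensorPerm h.right from map_mul (permAction k D n) _ _]
    · simp [monomialHom, permEntries, smul_smul, mul_comm]
    · simp [monomialHom, permEntries, smul_smul, mul_comm]

/-- The invariant algebra `D^n(a^n, σ^n)^{G(m, p, n)}`. -/
abbrev Inv (m p : ℕ) : Subalgebra k (TGWA a σ n) :=
  fixedSubalgebra (groupAction a σ n m p)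

/-- The map `D^* → D^n(a^n, σ^n)^{G(m, p, n)}` induced by `D^n → D^n(a^n, σ^n)`. -/
def starHom (m p : ℕ) : DStar k D n →ₐ[k] Inv a σ n m p :=
  ((GWA.ofBase (k := k) (elemAt k a) (sigmaAt σ)).comp (DStar k D n).val).codRestrict _
    fun d g => by
      have h : tensorPerm g.right d.1 = d.1 := d.2 g.right
      simp [groupAction, monomialHom, h]

/-- `D^*` as a subalgebra of `D^n(a^n, σ^n)^{G(m, p, n)}`. -/
def starSubalgebra (m p : ℕ) : Subalgebra k (Inv a σ n m p) := (starHom a σ n m p).range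

end Action

end GenWeyl

end

noncomputable section

namespace GenWeyl

universe u v w

/-! ### Extensions between simple modules over a commutative ring -/

section QuasiCommutative

open CategoryTheory

/-! Everything rests on a basis of the generalized Weyl algebra over `D^*` whose `k`-span is stable
under `G(m, p, n)`. If a module over a commutative `k`-algebra `R` has the form `R ⊗ V` and a family
of operators acts as the identity on `R` and through endomorphisms of `V`, then the common fixed
points are `R ⊗ V'`, where `V'` is the space of fixed vectors of `V`; so they form a free module
(`free_of_stable_basis`). No averaging over `G(m, p, n)` is needed.

The stable basis is a product of two. The monomials `X ^ μ`, `μ ∈ ℤ ^ n`, form a basis over `D^n`: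
they span because the generators reduce products to monomials, and a representation by twisted
shifts separates them (`monomialBasis`). The group permutes them up to scalars. In turn, `D^n` has a
finite basis over `D^*` whose `k`-span is stable under `S_n` (`exists_stable_basis_tpow`). For
polynomials, Artin's monomial basis over the symmetric polynomials is made stable by averaging over
`S_n`, in characteristic zero, the projection that evaluates coordinates at the origin; a graded
Nakayama argument shows that the result is still a basis. The Laurent case follows by inverting a
symmetric element.

The anti-automorphism `flip`, which fixes `D^n` and exchanges `X_i⁺` and `X_i⁻`, preserves the
invariants and turns statements on the left into statements on the right.

For quasi-centrality, `D^*` is noetherian, by descent from `D^n`, and `x D^n` stays inside the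
`D^n`-span of the finitely many monomials that occur in `x`. Quasi-commutativity is a property of
every commutative ring, since distinct maximal ideals are comaximal. -/

theorem exists_add_eq_one_of_isCoatom {Γ : Type v} [CommRing Γ] {I J : TwoSidedIdeal Γ}
    (hI : IsCoatom I) (hJ : IsCoatom J) (h : I ≠ J) : ∃ x ∈ I, ∃ y ∈ J, x + y = 1 := by
  have htop : I ⊔ J = ⊤ := hI.sup_eq_top_of_ne hJ h
  have h1 : (1 : Γ) ∈ I ⊔ J := htop ▸ trivial
  exact TwoSidedIdeal.mem_sup.1 h1

/-- The action of `Γ` on `Ext` can be computed through either argument. Write `1 = x + y` with `x ∈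
I` and `y ∈ J`: then `x` kills `Ext` through `S` and `y` kills it through `T`. -/
theorem isQuasiCommutative_of_commRing (k : Type u) [Field k] (Γ : Type v) [CommRing Γ]
    [Algebra k Γ] : IsQuasiCommutative k Γ := by
  intro I hI J hJ hne S T hS hT
  obtain ⟨x, hx, y, hy, hxy⟩ := exists_add_eq_one_of_isCoatom hI.1 hJ.1 hne
  refine subsingleton_of_forall_eq 0 fun e => ?_
  have hS' : x • 𝟙 S = 0 := by
    ext s
    exact hS.2 x hx s
  have hT' : y • 𝟙 T = 0 := by
    ext s
    exact hT.2 y hy s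
  have h1 : x • e = 0 := by
    have : x • e = (x • Abelian.Ext.mk₀ (𝟙 S)).comp e (zero_add 1) := by simp
    rw [this, ← Abelian.Ext.mk₀_smul, hS', Abelian.Ext.mk₀_zero, Abelian.Ext.zero_comp]
  have h2 : y • e = 0 := by
    rw [Abelian.Ext.smul_eq_comp_mk₀, hT', Abelian.Ext.mk₀_zero, Abelian.Ext.comp_zero]
  rw [← one_smul Γ e, ← hxy, add_smul, h1, h2, add_zero]

theorem isQuasiCommutative_of_mul_comm (k : Type u) [Field k] (Γ : Type v) [Ring Γ]
    [Algebra k Γ] (h : ∀ x y : Γ, x * y = y * x) : IsQuasiCommutative k Γ :=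
  letI : CommRing Γ := { ‹Ring Γ› with mul_comm := h }
  isQuasiCommutative_of_commRing k Γ

end QuasiCommutative

/-! ### The monomials span the generalized Weyl algebra -/

namespace GWA

section Monomials

variable {k : Type u} {D : Type v} {ι : Type w} [CommRing k] [CommRing D] [Algebra k D]
  (a : ι → D) (σ : ι → (D ≃ₐ[k] D))

/-- `D(a, σ)` is a left `D`-module through the structure map. -/
instance moduleBase : Module D (GWA a σ) := Module.compHom _ (ofBase a σ).toRingHom

variable {a σ} in
theorem base_smul_def (d : D) (x : GWA a σ) : d • x = ofBase a σ d * x := rfl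

instance : IsScalarTower k D (GWA a σ) :=
  ⟨fun r d x => by rw [base_smul_def, base_smul_def, map_smul, smul_mul_assoc]⟩

instance : IsScalarTower D (GWA a σ) (GWA a σ) :=
  ⟨fun d x y => by
    rw [base_smul_def, smul_eq_mul, smul_eq_mul, base_smul_def, mul_assoc]⟩

/-- The power of `X_i⁺` with exponent `m` if `0 ≤ m`, and the power of `X_i⁻` with exponent `-m`
otherwise. -/
def xpow (i : ι) (m : ℤ) : GWA a σ := Xp a σ i ^ m.toNat * Xm a σ i ^ (-m).toNat

@[simp]
theorem xpow_zero (i : ι) : xpow a σ i 0 = 1 := by simp [xpow]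

theorem xpow_natCast (i : ι) (m : ℕ) : xpow a σ i m = Xp a σ i ^ m := by
  simp [xpow]

theorem xpow_neg_natCast (i : ι) (m : ℕ) : xpow a σ i (-m) = Xm a σ i ^ m := by
  simp [xpow]

theorem commute_xpow {i j : ι} (h : i ≠ j) (m l : ℤ) :
    Commute (xpow a σ i m) (xpow a σ j l) :=
  .mul_left
    (.mul_right (.pow_pow (Xp_Xp h) _ _) (.pow_pow (Xp_Xm h) _ _))
    (.mul_right (.pow_pow (Xp_Xm h.symm).symm _ _) (.pow_pow (Xm_Xm h) _ _))

theorem exists_Xp_mul_xpow (i : ι) (m : ℤ) :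
    ∃ c : D, Xp a σ i * xpow a σ i m = c • xpow a σ i (m + 1) := by
  obtain ⟨m, rfl | rfl⟩ := m.eq_nat_or_neg
  · refine ⟨1, ?_⟩
    rw [one_smul, xpow_natCast, ← pow_succ', ← xpow_natCast]
    simp
  · cases m with
    | zero =>
      refine ⟨1, ?_⟩
      have := xpow_natCast a σ i 1
      simp_all
    | succ m =>
      refine ⟨σ i (a i), ?_⟩
      rw [xpow_neg_natCast, pow_succ', ← mul_assoc, Xp_Xm_self, base_smul_def,
        ← xpow_neg_natCast]
      congr 2
      push_cast
      ring

theorem exists_Xm_mul_xpow (i : ι) (m : ℤ) :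
    ∃ c : D, Xm a σ i * xpow a σ i m = c • xpow a σ i (m - 1) := by
  obtain ⟨m, rfl | rfl⟩ := m.eq_nat_or_neg
  · cases m with
    | zero =>
      refine ⟨1, ?_⟩
      have := xpow_neg_natCast a σ i 1
      simp_all
    | succ m =>
      refine ⟨a i, ?_⟩
      rw [xpow_natCast, pow_succ', ← mul_assoc, Xm_Xp_self, base_smul_def, ← xpow_natCast]
      congr 2
      push_cast
      ring
  · refine ⟨1, ?_⟩
    rw [one_smul, xpow_neg_natCast, ← pow_succ', ← xpow_neg_natCast]
    congr 1
    push_cast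
    ring

variable {a σ} in
/-- A `k`-subspace of `D(a, σ)` that contains `1` and is stable under left multiplication by the
generators is everything. -/
theorem eq_top_of_mul_mem (N : Submodule k (GWA a σ)) (h1 : 1 ∈ N)
    (hb : ∀ d, ∀ x ∈ N, ofBase a σ d * x ∈ N) (hp : ∀ i, ∀ x ∈ N, Xp a σ i * x ∈ N)
    (hm : ∀ i, ∀ x ∈ N, Xm a σ i * x ∈ N) : N = ⊤ := by
  refine eq_top_iff.2 fun x _ => ?_
  suffices h : ∀ f : FreeAlgebra k (Gen D ι), ∀ y ∈ N, mk a σ f * y ∈ N by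
    obtain ⟨f, rfl⟩ : ∃ f, mk a σ f = x := RingQuot.mkAlgHom_surjective k (Rel a σ) x
    simpa using h f 1 h1
  intro f
  induction f using FreeAlgebra.induction with
  | grade0 r =>
    intro y hy
    rw [AlgHom.commutes, ← Algebra.smul_def]
    exact N.smul_mem r hy
  | grade1 s =>
    intro y hy
    cases s with
    | base d => exact hb d y hy
    | plus i => exact hp i y hy
    | minus i => exact hm i y hy
  | mul f g hf hg =>
    intro y hy
    rw [map_mul, mul_assoc]
    exact hf _ (hg _ hy)
  | add f g hf hg =>
    intro y hy
    rw [map_add, add_mul]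
    exact N.add_mem (hf _ hy) (hg _ hy)

theorem pairwise_commute_xpow (μ : ι → ℤ) (s : Set ι) :
    s.Pairwise (Function.onFun Commute fun i => xpow a σ i (μ i)) :=
  fun _ _ _ _ h => commute_xpow a σ h _ _

variable [Fintype ι]

/-- The monomial `X ^ μ`, the product of the powers of the `X_i^±` with exponents `μ i`. -/
def monomial (μ : ι → ℤ) : GWA a σ :=
  Finset.univ.noncommProd (fun i => xpow a σ i (μ i)) (pairwise_commute_xpow a σ μ _)

@[simp]
theorem monomial_zero : monomial a σ 0 = 1 :=
  (Finset.noncommProd_eq_pow_card _ _ _ 1 (by simp)).trans (one_pow _)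

section Span

variable [DecidableEq ι]

/-- The powers for different indices commute, so the one for `i` can be pulled to the front. The
cofactor `z` does not depend on `m`, which reduces multiplication by `X_i^±` to one variable. -/
theorem exists_monomial_eq (μ : ι → ℤ) (i : ι) :
    ∃ z : GWA a σ, ∀ m : ℤ, monomial a σ (Function.update μ i m) = xpow a σ i m * z := by
  refine ⟨(Finset.univ.erase i).noncommProd (fun j => xpow a σ j (μ j))
    (pairwise_commute_xpow a σ μ _), fun m => ?_⟩
  rw [monomial, ← Finset.mul_noncommProd_erase _ (Finset.mem_univ i)]
  congr 1
  · simp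
  · refine Finset.noncommProd_congr rfl (fun j hj => ?_) _
    rw [Function.update_of_ne (Finset.ne_of_mem_erase hj)]

theorem exists_Xp_mul_monomial (i : ι) (μ : ι → ℤ) :
    ∃ (c : D) (ν : ι → ℤ), Xp a σ i * monomial a σ μ = c • monomial a σ ν := by
  obtain ⟨z, hz⟩ := exists_monomial_eq a σ μ i
  obtain ⟨c, hc⟩ := exists_Xp_mul_xpow a σ i (μ i)
  have h := hz (μ i)
  rw [Function.update_eq_self] at h
  exact ⟨c, _, (by rw [h, ← mul_assoc, hc, smul_mul_assoc, ← hz] : _ = c • monomial a σ (Function.update μ i (μ i + 1)))⟩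

theorem exists_Xm_mul_monomial (i : ι) (μ : ι → ℤ) :
    ∃ (c : D) (ν : ι → ℤ), Xm a σ i * monomial a σ μ = c • monomial a σ ν := by
  obtain ⟨z, hz⟩ := exists_monomial_eq a σ μ i
  obtain ⟨c, hc⟩ := exists_Xm_mul_xpow a σ i (μ i)
  have h := hz (μ i)
  rw [Function.update_eq_self] at h
  exact ⟨c, _, (by rw [h, ← mul_assoc, hc, smul_mul_assoc, ← hz] : _ = c • monomial a σ (Function.update μ i (μ i - 1)))⟩

theorem span_monomial : Submodule.span D (Set.range (monomial a σ)) = ⊤ := by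
  set N := Submodule.span D (Set.range (monomial a σ)) with hN
  -- Left multiplication by a generator is only semilinear over `D`, with twist `τ`; this is enough
  -- to check stability of the span on the monomials.
  have key : ∀ (x : GWA a σ) (τ : D → D), (∀ d, x * ofBase a σ d = ofBase a σ (τ d) * x) →
      (∀ μ, x * monomial a σ μ ∈ N) → ∀ y ∈ N, x * y ∈ N := by
    intro x τ hτ hx y hy
    induction hy using Submodule.span_induction with
    | mem y hy =>
      obtain ⟨μ, rfl⟩ := hy
      exact hx μ
    | zero => simp
    | add y z _ _ hy hz =>
      rw [mul_add]
      exact N.add_mem hy hz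
    | smul d y _ hy =>
      rw [base_smul_def, ← mul_assoc, hτ, mul_assoc]
      exact N.smul_mem _ hy
  have := eq_top_of_mul_mem (N.restrictScalars k)
    (Submodule.subset_span ⟨0, monomial_zero a σ⟩)
    (fun d x hx => N.smul_mem d hx)
    (fun i => key _ (σ i) (Xp_base i) fun μ => by
      obtain ⟨c, ν, h⟩ := exists_Xp_mul_monomial a σ i μ
      exact h ▸ N.smul_mem c (Submodule.subset_span ⟨ν, rfl⟩))
    (fun i => key _ (σ i).symm (Xm_base i) fun μ => by
      obtain ⟨c, ν, h⟩ := exists_Xm_mul_monomial a σ i μ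
      exact h ▸ N.smul_mem c (Submodule.subset_span ⟨ν, rfl⟩))
  exact (Submodule.restrictScalars_eq_top_iff k D (GWA a σ)).1 this

end Span

end Monomials

/-! ### Linear independence of the monomials through twisted shifts -/

section Representation

variable {k : Type u} {D : Type v} {ι : Type w} [CommRing k] [CommRing D] [Algebra k D]
  {a : ι → D} {σ : ι → (D ≃ₐ[k] D)}
  (hσ : ∀ i j d, σ i (σ j d) = σ j (σ i d)) (ha : ∀ i j, i ≠ j → σ i (a j) = a j)

include hσ in
theorem symm_comm (i j : ι) (d : D) : σ i ((σ j).symm d) = (σ j).symm (σ i d) := by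
  rw [AlgEquiv.eq_symm_apply, ← hσ, AlgEquiv.apply_symm_apply]

include hσ in
theorem symm_symm_comm (i j : ι) (d : D) :
    (σ i).symm ((σ j).symm d) = (σ j).symm ((σ i).symm d) := by
  rw [AlgEquiv.symm_apply_eq, symm_comm hσ, AlgEquiv.apply_symm_apply]

include ha in
theorem symm_fixed {i j : ι} (h : i ≠ j) : (σ i).symm (a j) = a j := by
  rw [AlgEquiv.symm_apply_eq, ha i j h]

variable [Fintype ι] [DecidableEq ι]

/-- The representation of `D(a, σ)` on the `D`-valued functions on `ℤ ^ ι` for which `X_i⁺`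
is a shift twisted by `σ i`. -/
def shiftRep : GWA a σ →ₐ[k] Module.End k ((ι → ℤ) → D) :=
  lift (Algebra.lsmul k k ((ι → ℤ) → D))
    (fun i =>
      { toFun := fun f μ => σ i (f (μ - Pi.single i 1))
        map_add' := fun f g => by ext; simp
        map_smul' := fun r f => by ext; simp })
    (fun i =>
      { toFun := fun f μ => a i * (σ i).symm (f (μ + Pi.single i 1))
        map_add' := fun f g => by ext; simp [mul_add]
        map_smul' := fun r f => by ext; simp })
    (fun i d => by ext; simp)
    (fun i d => by ext; simp; ring)
    (fun i j _ => by ext; simp [hσ i j, sub_right_comm])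
    (fun i j h => by
      ext f μ
      simp only [Module.End.mul_apply, LinearMap.coe_mk, AddHom.coe_mk, map_mul,
        symm_fixed ha h, symm_fixed ha h.symm, symm_symm_comm hσ i j, add_right_comm]
      ring)
    (fun i j h => by
      ext f μ
      simp only [Module.End.mul_apply, LinearMap.coe_mk, AddHom.coe_mk, map_mul,
        ha i j h, symm_comm hσ i j, sub_add_eq_add_sub])
    (fun i => by ext; simp)
    (fun i => by ext; simp)

theorem shiftRep_Xp_single (i : ι) (μ : ι → ℤ) (c : D) :
    shiftRep hσ ha (Xp a σ i) (Pi.single μ c) = Pi.single (μ + Pi.single i 1) (σ i c) := by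
  ext ν
  simp only [shiftRep, lift_Xp, LinearMap.coe_mk, AddHom.coe_mk, Pi.single_apply,
    sub_eq_iff_eq_add]
  split_ifs <;> simp

theorem shiftRep_Xm_single (i : ι) (μ : ι → ℤ) (c : D) :
    shiftRep hσ ha (Xm a σ i) (Pi.single μ c) =
      Pi.single (μ - Pi.single i 1) (a i * (σ i).symm c) := by
  ext ν
  simp only [shiftRep, lift_Xm, LinearMap.coe_mk, AddHom.coe_mk, Pi.single_apply,
    eq_sub_iff_add_eq]
  split_ifs <;> simp

variable [IsDomain D] (ha0 : ∀ i, a i ≠ 0)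

include ha0 in
theorem exists_shiftRep_xpow (i : ι) (m : ℤ) (μ : ι → ℤ) (c : D) (hc : c ≠ 0) :
    ∃ c' : D, c' ≠ 0 ∧ shiftRep hσ ha (xpow a σ i m) (Pi.single μ c) =
      Pi.single (μ + Pi.single i m) c' := by
  obtain ⟨m, rfl | rfl⟩ := m.eq_nat_or_neg
  · rw [xpow_natCast]
    induction m with
    | zero => exact ⟨c, hc, by simp⟩
    | succ m ih =>
      obtain ⟨c', hc', h⟩ := ih
      refine ⟨σ i c', by simpa using hc', ?_⟩
      rw [pow_succ', map_mul, Module.End.mul_apply, h, shiftRep_Xp_single, add_assoc,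
        ← Pi.single_add]
      simp
  · rw [xpow_neg_natCast]
    induction m with
    | zero => exact ⟨c, hc, by simp⟩
    | succ m ih =>
      obtain ⟨c', hc', h⟩ := ih
      refine ⟨a i * (σ i).symm c', mul_ne_zero (ha0 i) (by simpa using hc'), ?_⟩
      rw [pow_succ', map_mul, Module.End.mul_apply, h, shiftRep_Xm_single, add_sub_assoc,
        ← Pi.single_sub]
      congr 3
      push_cast
      ring

include ha0 in
theorem exists_shiftRep_monomial (μ : ι → ℤ) :
    ∃ c : D, c ≠ 0 ∧ shiftRep hσ ha (monomial a σ μ) (Pi.single 0 1) = Pi.single μ c := by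
  have key : ∀ s : Finset ι, ∃ c : D, c ≠ 0 ∧
      shiftRep hσ ha (s.noncommProd (fun i => xpow a σ i (μ i))
        (pairwise_commute_xpow a σ μ _)) (Pi.single 0 1) =
        Pi.single (∑ i ∈ s, Pi.single i (μ i)) c := by
    intro s
    induction s using Finset.induction_on with
    | empty => exact ⟨1, one_ne_zero, by rw [Finset.noncommProd_empty]; simp⟩
    | insert i s hi ih =>
      obtain ⟨c, hc, h⟩ := ih
      obtain ⟨c', hc', h'⟩ := exists_shiftRep_xpow hσ ha ha0 i (μ i) _ c hc
      refine ⟨c', hc', ?_⟩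
      rw [Finset.noncommProd_insert_of_notMem _ _ _ _ hi, map_mul, Module.End.mul_apply, h, h',
        Finset.sum_insert hi, add_comm]
  obtain ⟨c, hc, h⟩ := key Finset.univ
  exact ⟨c, hc, by rw [monomial, h, Finset.univ_sum_single]⟩

include hσ ha ha0 in
-- Applied to the delta function at `0`, `X ^ μ` gives a nonzero multiple of the delta function at
-- `μ`. Evaluating a relation at `μ` therefore isolates its coefficient at `μ`.
theorem linearIndependent_monomial : LinearIndependent D (monomial a σ) := by
  rw [linearIndependent_iff']
  intro s g hg μ hμ
  choose c hc h using exists_shiftRep_monomial hσ ha ha0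
  have h0 := congrArg (fun x => shiftRep hσ ha x (Pi.single 0 1) μ) hg
  simp only [map_sum, LinearMap.sum_apply, Finset.sum_apply, map_zero, LinearMap.zero_apply,
    Pi.zero_apply] at h0
  rw [Finset.sum_eq_single_of_mem μ hμ] at h0
  · rw [base_smul_def, map_mul, Module.End.mul_apply, h] at h0
    simpa [shiftRep, hc μ] using h0
  · intro ν _ hν
    rw [base_smul_def, map_mul, Module.End.mul_apply, h]
    simp [shiftRep, hν.symm]

/-- The monomials `X ^ μ` form a basis of `D(a, σ)` as a left `D`-module. -/
def monomialBasis : Module.Basis (ι → ℤ) D (GWA a σ) :=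
  .mk (linearIndependent_monomial hσ ha ha0) (span_monomial a σ).ge

@[simp]
theorem monomialBasis_apply (μ : ι → ℤ) : monomialBasis hσ ha ha0 μ = monomial a σ μ :=
  Module.Basis.mk_apply _ _ _

end Representation

end GWA

/-! ### The anti-automorphism that exchanges left and right -/

namespace GWA

section Flip

variable {k : Type u} {D : Type v} {ι : Type w} [CommRing k] [CommRing D] [Algebra k D]
  (a : ι → D) (σ : ι → (D ≃ₐ[k] D))

open MulOpposite

/-- The homomorphism `D(a, σ) → D(a, σ)ᵒᵖ` that is the identity on `D` and exchanges `X_i⁺` and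
`X_i⁻`. -/
def flipHom : GWA a σ →ₐ[k] (GWA a σ)ᵐᵒᵖ :=
  lift ((ofBase a σ).toOpposite fun d e => by rw [commute_iff_eq, ← map_mul, mul_comm, map_mul])
    (fun i => op (Xm a σ i)) (fun i => op (Xp a σ i))
    (fun i d => unop_injective (by simp [Xm_base]))
    (fun i d => unop_injective (by simp [Xp_base]))
    (fun i j h => unop_injective (by simp [Xm_Xm h]))
    (fun i j h => unop_injective (by simp [Xp_Xp h]))
    (fun i j h => unop_injective (by simp [Xp_Xm h.symm]))
    (fun i => unop_injective (by simp [Xm_Xp_self]))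
    (fun i => unop_injective (by simp [Xp_Xm_self]))

theorem opComm_flipHom_comp_flipHom :
    (AlgHom.opComm (flipHom a σ)).comp (flipHom a σ) = AlgHom.id k _ := by
  apply hom_ext <;> intro x <;> simp [flipHom]

/-- The anti-automorphism of `D(a, σ)` that is the identity on `D` and exchanges `X_i⁺` and
`X_i⁻`. -/
def flip : GWA a σ ≃ₗ[k] GWA a σ :=
  LinearEquiv.ofInvolutive
    ((opLinearEquiv k).symm.toLinearMap ∘ₗ (flipHom a σ).toLinearMap)
    fun x => DFunLike.congr_fun (opComm_flipHom_comp_flipHom a σ) x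

variable {a σ}

theorem flip_apply (x : GWA a σ) : flip a σ x = unop (flipHom a σ x) := rfl

@[simp]
theorem flip_flip (x : GWA a σ) : flip a σ (flip a σ x) = x :=
  DFunLike.congr_fun (opComm_flipHom_comp_flipHom a σ) x

theorem flip_mul (x y : GWA a σ) : flip a σ (x * y) = flip a σ y * flip a σ x := by
  simp [flip_apply]

@[simp]
theorem flip_ofBase (d : D) : flip a σ (ofBase a σ d) = ofBase a σ d := by
  simp [flip_apply, flipHom]

end Flip

end GWA

/-! ### Commuting automorphisms and nonvanishing in tensor powers -/

section TensorPower

variable {k : Type u} {D : Type v} [CommRing k] [CommRing D] [Algebra k D] {n : ℕ}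

theorem sigmaAt_comm (σ : D ≃ₐ[k] D) (i j : Fin n) (x : TPow k D n) :
    sigmaAt σ i (sigmaAt σ j x) = sigmaAt σ j (sigmaAt σ i x) := by
  rcases eq_or_ne i j with rfl | h
  · rfl
  have : (sigmaAt σ i : TPow k D n →ₐ[k] TPow k D n).comp
      (sigmaAt σ j : TPow k D n →ₐ[k] TPow k D n) =
      (sigmaAt σ j : TPow k D n →ₐ[k] TPow k D n).comp
      (sigmaAt σ i : TPow k D n →ₐ[k] TPow k D n) :=
    tpow_hom_ext fun x => by
      simp only [AlgHom.comp_apply, AlgEquiv.coe_toAlgHom, sigmaAt_tprod]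
      rw [Function.update_of_ne h, Function.update_of_ne h.symm, Function.update_comm h]
  exact DFunLike.congr_fun this x

theorem sigmaAt_elemAt_of_ne (σ : D ≃ₐ[k] D) {i j : Fin n} (h : i ≠ j) (d : D) :
    sigmaAt σ i (elemAt k d j) = elemAt k d j := by
  rw [elemAt, sigmaAt_tprod]
  congr 1
  rw [Function.update_of_ne h, map_one, Function.update_eq_self_iff, Function.update_of_ne h]

/-- In the product basis, the coordinates of a pure tensor are products of coordinates of its
factors; choose a nonzero one for each factor. -/
theorem tprod_ne_zero {k : Type u} [Field k] [Algebra k D] {x : Fin n → D} (hx : ∀ i, x i ≠ 0) :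
    (PiTensorProduct.tprod k x : TPow k D n) ≠ 0 := by
  intro h
  let b := Module.Basis.ofVectorSpace k D
  have hp : ∀ i, ∃ p, b.repr (x i) p ≠ 0 := fun i => by
    by_contra! h0
    exact hx i (b.repr.injective (by ext p; simpa using h0 p))
  choose p hp using hp
  have := Basis.piTensorProduct_repr_tprod_apply (R := k) (fun _ : Fin n => b) x p
  rw [h, map_zero, Finsupp.zero_apply] at this
  exact Finset.prod_ne_zero_iff.2 (fun i _ => hp i) this.symm

theorem elemAt_ne_zero {k : Type u} [Field k] [Algebra k D] {d : D} (hd : d ≠ 0) (i : Fin n) :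
    elemAt k d i ≠ 0 := by
  have : Nontrivial D := ⟨d, 0, hd⟩
  refine tprod_ne_zero fun j => ?_
  rcases eq_or_ne j i with rfl | h <;> simp [*]

end TensorPower

/-! ### The group action on monomials and its compatibility with `flip` -/

section Symmetries

variable {k : Type u} {D : Type v} [Field k] [CommRing D] [Algebra k D] (a : D) (σ : D ≃ₐ[k] D)
  {n : ℕ}

theorem monomialHom_base_smul (ζ : Fin n → kˣ) (π : Equiv.Perm (Fin n)) (d : TPow k D n)
    (x : TGWA a σ n) :
    monomialHom a σ n ζ π (d • x) = tensorPerm π d • monomialHom a σ n ζ π x := by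
  simp [GWA.base_smul_def, monomialHom]

theorem exists_monomialHom_xpow (ζ : Fin n → kˣ) (π : Equiv.Perm (Fin n)) (i : Fin n) (m : ℤ) :
    ∃ r : k, monomialHom a σ n ζ π (GWA.xpow _ _ i m) = r • GWA.xpow _ _ (π i) m :=
  ⟨(ζ (π i) : k) ^ m.toNat * ((ζ (π i))⁻¹ : kˣ).val ^ (-m).toNat, by
    simp only [monomialHom, GWA.xpow, map_mul, map_pow, GWA.lift_Xp, GWA.lift_Xm, smul_pow,
      smul_mul_smul_comm]⟩

/-- What matters is that the factor lies in `k`, not merely in `D^n`: the `k`-span of the monomials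
is then stable under the group. -/
theorem exists_monomialHom_monomial (ζ : Fin n → kˣ) (π : Equiv.Perm (Fin n)) (μ : Fin n → ℤ) :
    ∃ r : k, monomialHom a σ n ζ π (GWA.monomial _ _ μ) = r • GWA.monomial _ _ (μ ∘ ⇑π⁻¹) := by
  have key : ∀ s : Finset (Fin n), ∃ r : k, monomialHom a σ n ζ π
      (s.noncommProd (fun i => GWA.xpow _ _ i (μ i)) (GWA.pairwise_commute_xpow _ _ μ _)) =
      r • (s.map π.toEmbedding).noncommProd (fun i => GWA.xpow _ _ i ((μ ∘ ⇑π⁻¹) i))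
        (GWA.pairwise_commute_xpow _ _ _ _) := by
    intro s
    induction s using Finset.induction_on with
    | empty => exact ⟨1, by simp [Finset.noncommProd_empty]⟩
    | insert i s hi ih =>
      obtain ⟨r, hr⟩ := ih
      obtain ⟨t, ht⟩ := exists_monomialHom_xpow a σ ζ π i (μ i)
      refine ⟨t * r, ?_⟩
      have hi' : π i ∉ s.map π.toEmbedding := by simpa using hi
      rw [Finset.noncommProd_insert_of_notMem _ _ _ _ hi, map_mul, hr, ht, smul_mul_smul_comm]
      congr 1
      have := Finset.noncommProd_insert_of_notMem (s.map π.toEmbedding) (π i)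
        (fun i => GWA.xpow (elemAt k a) (sigmaAt σ) i ((μ ∘ ⇑π⁻¹) i))
        (GWA.pairwise_commute_xpow _ _ _ _) hi'
      have hμ : (μ ∘ ⇑π⁻¹) (π i) = μ i := by simp
      rw [hμ] at this
      exact this.symm.trans <| Finset.noncommProd_congr (by simp [Finset.map_insert]) (fun _ _ => rfl) _
  obtain ⟨r, hr⟩ := key Finset.univ
  refine ⟨r, hr.trans (congrArg (r • ·) ?_)⟩
  exact Finset.noncommProd_congr (Finset.map_univ_equiv π) (fun _ _ => rfl) _

theorem flip_monomialHom (ζ : Fin n → kˣ) (π : Equiv.Perm (Fin n)) (x : TGWA a σ n) :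
    GWA.flip _ _ (monomialHom a σ n ζ π x) = monomialHom a σ n ζ⁻¹ π (GWA.flip _ _ x) := by
  have : (GWA.flipHom _ _).comp (monomialHom a σ n ζ π) =
      (AlgHom.op (monomialHom a σ n ζ⁻¹ π)).comp (GWA.flipHom _ _) := by
    apply GWA.hom_ext <;> intro x <;> simp [GWA.flipHom, monomialHom]
  exact congrArg MulOpposite.unop (DFunLike.congr_fun this x)

theorem flip_mem_inv {m p : ℕ} {x : TGWA a σ n} (hx : x ∈ Inv a σ n m p) :
    GWA.flip _ _ x ∈ Inv a σ n m p := by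
  intro g
  -- The tuple is inverted in advance because passing through `flip` inverts it again.
  have h := hx ⟨g.left⁻¹, g.right⟩
  rw [← h]
  refine Eq.trans ?_ (flip_monomialHom a σ _ _ x).symm
  rw [h]
  refine DFunLike.congr_fun (congrArg (fun ζ => monomialHom a σ n ζ g.right) ?_) _
  ext i
  simp

end Symmetries

/-! ### Artin's monomial basis over the fixed ring -/

section PermutedGenerators

variable {R : Type u} {P : Type v} [CommRing R] [CommRing P] [Algebra R P] {n : ℕ}

/-- The algebra generated over `R` by the `x i` with `i < j`. -/
def adjoinLT (R : Type u) {P : Type v} [CommRing R] [CommRing P] [Algebra R P] {n : ℕ}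
    (x : Fin n → P) (j : ℕ) : Subalgebra R P :=
  Algebra.adjoin R (x '' {i : Fin n | (i : ℕ) < j})

variable {x : Fin n → P}

theorem mem_adjoinLT {i : Fin n} {j : ℕ} (h : (i : ℕ) < j) : x i ∈ adjoinLT R x j :=
  Algebra.subset_adjoin ⟨i, h, rfl⟩

theorem adjoinLT_mono {i j : ℕ} (h : i ≤ j) : adjoinLT R x i ≤ adjoinLT R x j :=
  Algebra.adjoin_mono (Set.image_mono fun _ hl => lt_of_lt_of_le hl h)

theorem adjoinLT_self : adjoinLT R x n = Algebra.adjoin R (Set.range x) := by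
  rw [adjoinLT, ← Set.image_univ]
  congr 2
  ext i
  simp

theorem adjoinLT_succ (j : Fin n) :
    adjoinLT R x (j + 1) = (Algebra.adjoin (adjoinLT R x j) {x j}).restrictScalars R := by
  rw [adjoinLT, adjoinLT, ← Algebra.adjoin_union_eq_adjoin_adjoin]
  congr 1
  rw [Set.union_singleton, ← Set.image_insert_eq]
  congr 1
  ext i
  simp [Fin.ext_iff, le_iff_eq_or_lt]

/-- Automorphisms of `P` over `R` that permute the elements `x i`. -/
structure PermutesGenerators (x : Fin n → P) (ρ : Equiv.Perm (Fin n) → (P →ₐ[R] P)) : Prop where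
  apply_gen : ∀ e i, ρ e (x i) = x (e i)
  mem_of_fixed : ∀ f, (∀ e, ρ e f = f) → f ∈ (algebraMap R P).range
  gen_injective : Function.Injective x

variable {ρ : Equiv.Perm (Fin n) → (P →ₐ[R] P)} (hρ : PermutesGenerators x ρ)

namespace PermutesGenerators

include hρ

theorem eq_self_of_mem_adjoinLT {j : ℕ} {f : P} (hf : f ∈ adjoinLT R x j)
    (e : Equiv.Perm (Fin n)) (he : ∀ i : Fin n, (i : ℕ) < j → e i = i) : ρ e f = f := by
  induction hf using Algebra.adjoin_induction with
  | mem f hf =>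
    obtain ⟨i, hi, rfl⟩ := hf
    rw [hρ.apply_gen, he i hi]
  | algebraMap r => exact AlgHom.commutes _ r
  | add f g _ _ hf hg => rw [map_add, hf, hg]
  | mul f g _ _ hf hg => rw [map_mul, hf, hg]

/-- A relation is a polynomial of degree less than `n - j` that vanishes at `x j`. For `i ≥ j`, the
transposition of `j` and `i` fixes its coefficients, so `x i` is a root too. These are `n - j`
distinct roots in a domain. -/
theorem linearIndependent_pow [IsDomain P] (j : Fin n) :
    LinearIndependent (adjoinLT R x j) fun l : Fin (n - j) => x j ^ (l : ℕ) := by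
  rw [Fintype.linearIndependent_iff]
  intro g hg
  set F : Polynomial P :=
    ∑ l : Fin (n - j), Polynomial.C (g l).1 * Polynomial.X ^ (l : ℕ) with hF
  have hdeg : F.natDegree < n - j := by
    have hpos : 0 < n - (j : ℕ) := by omega
    refine lt_of_le_of_lt (Polynomial.natDegree_sum_le_of_forall_le (n := n - j - 1) _ _ ?_)
      (by omega)
    intro l _
    exact (Polynomial.natDegree_C_mul_X_pow_le _ _).trans (by omega)
  have hroot : ∀ i : Fin n, j ≤ i → F.eval (x i) = 0 := by
    intro i hi
    have h := congrArg (ρ (Equiv.swap j i)) hg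
    rw [map_zero, map_sum] at h
    rw [hF, Polynomial.eval_finsetSum, ← h]
    refine Finset.sum_congr rfl fun l _ => ?_
    rw [Subalgebra.smul_def, smul_eq_mul, map_mul, map_pow, hρ.apply_gen, Equiv.swap_apply_left,
      hρ.eq_self_of_mem_adjoinLT (g l).2]
    · simp
    · intro i' hi'
      apply Equiv.swap_apply_of_ne_of_ne <;> rintro rfl <;> omega
  have hF0 : F = 0 := by
    refine Polynomial.eq_zero_of_natDegree_lt_card_of_eval_eq_zero F
      (f := fun i : Set.Ici j => x i.1) (hρ.gen_injective.comp Subtype.val_injective)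
      (fun i => hroot i.1 i.2) ?_
    simpa using hdeg
  intro l
  have h := congrArg (fun p => p.coeff l) hF0
  simp only [hF, Polynomial.finsetSum_coeff, Polynomial.coeff_C_mul_X_pow,
    Polynomial.coeff_zero] at h
  rw [Finset.sum_eq_single l] at h
  · simpa using h
  · intro b _ hb
    rw [if_neg fun e => hb (Fin.ext e.symm)]
  · simp

/-- For `j = 0` the coefficients are fixed by all permutations, hence come from `R`. Passing from
`j` to `j + 1` divides by the monic polynomial `X - x_j`, which introduces only powers of `x j` into
the coefficients. -/
theorem coeff_prod_X_sub_C_mem (j : ℕ) (l : ℕ) :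
    (∏ i ∈ Finset.univ.filter fun i : Fin n => j ≤ i,
      (Polynomial.X - Polynomial.C (x i))).coeff l ∈ adjoinLT R x j := by
  induction j generalizing l with
  | zero =>
    obtain ⟨r, hr⟩ := hρ.mem_of_fixed ((∏ i ∈ Finset.univ.filter fun i : Fin n => 0 ≤ (i : ℕ),
      (Polynomial.X - Polynomial.C (x i))).coeff l) fun e => by
        rw [← AlgHom.coe_toRingHom, ← Polynomial.coeff_map, Polynomial.map_prod]
        congr 1
        simpa [hρ.apply_gen] using Equiv.prod_comp e fun i => Polynomial.X - Polynomial.C (x i)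
    exact hr ▸ (adjoinLT R x 0).algebraMap_mem r
  | succ j ih =>
    by_cases hj : j < n
    · have h : (Finset.univ.filter fun i : Fin n => j ≤ i) =
          insert ⟨j, hj⟩ (Finset.univ.filter fun i : Fin n => j + 1 ≤ i) := by
        ext i
        simp only [Finset.mem_filter, Finset.mem_univ, true_and, Finset.mem_insert, Fin.ext_iff]
        omega
      rw [h, Finset.prod_insert (by simp)] at ih
      set q := ∏ i ∈ Finset.univ.filter fun i : Fin n => j + 1 ≤ i,
        (Polynomial.X - Polynomial.C (x i))
      have hq : q = ((Polynomial.X - Polynomial.C (x ⟨j, hj⟩)) * q) /ₘ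
          (Polynomial.X - Polynomial.C (x ⟨j, hj⟩)) :=
        (Polynomial.mul_divByMonic_cancel_left _ (Polynomial.monic_X_sub_C _)).symm
      rw [hq, Polynomial.coeff_divByMonic_X_sub_C]
      exact sum_mem fun i _ => mul_mem (pow_mem (mem_adjoinLT (Nat.lt_succ_self j)) _)
        (adjoinLT_mono j.le_succ (ih i))
    · have h : (Finset.univ.filter fun i : Fin n => j + 1 ≤ i) =
          Finset.univ.filter fun i : Fin n => j ≤ i :=
        Finset.filter_congr fun i _ => by omega
      rw [h]
      exact adjoinLT_mono j.le_succ (ih l)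

/-- The product of the `X - x_i` with `i ≥ j` is a monic equation of degree `n - j` for `x j` over
`adjoinLT R x j`. -/
theorem span_pow [Nontrivial P] (j : Fin n) :
    Submodule.span (adjoinLT R x j) (Set.range fun l : Fin (n - j) => x j ^ (l : ℕ)) =
      Subalgebra.toSubmodule (Algebra.adjoin (adjoinLT R x j) {x j}) := by
  set F := ∏ i ∈ Finset.univ.filter fun i : Fin n => (j : ℕ) ≤ i,
    (Polynomial.X - Polynomial.C (x i)) with hF
  have hmonic : F.Monic :=
    Polynomial.monic_prod_of_monic _ _ fun i _ => Polynomial.monic_X_sub_C _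
  have hdeg : F.natDegree = n - j := by
    rw [hF, Polynomial.natDegree_finsetProd_X_sub_C_eq_card]
    have : (Finset.univ.filter fun i : Fin n => (j : ℕ) ≤ i) = Finset.Ici j := by ext; simp
    rw [this, Fin.card_Ici]
  have hlift : F ∈ Polynomial.lifts (algebraMap (adjoinLT R x j) P) := by
    rw [Polynomial.lifts_iff_coeff_lifts]
    exact fun l => ⟨⟨_, hρ.coeff_prod_X_sub_C_mem j l⟩, rfl⟩
  obtain ⟨f, hf, hfdeg, hfmonic⟩ := Polynomial.lifts_and_natDegree_eq_and_monic hlift hmonic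
  rw [← Submodule.span_range_natDegree_eq_adjoin hfmonic, hfdeg, hdeg]
  · congr 1
    ext y
    simp only [Set.mem_range, Finset.coe_image, Finset.coe_range, Set.mem_image, Set.mem_Iio]
    exact ⟨fun ⟨l, h⟩ => ⟨l, l.2, h⟩, fun ⟨l, hl, h⟩ => ⟨⟨l, hl⟩, h⟩⟩
  · rw [Polynomial.aeval_def, ← Polynomial.eval_map, hf, Polynomial.eval_prod]
    exact Finset.prod_eq_zero (i := j) (by simp) (by simp)

theorem exists_basis_adjoinLT [IsDomain P] [FaithfulSMul R P] (j : ℕ) (hj : j ≤ n) :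
    ∃ (ι : Type) (_ : Fintype ι) (d : ι → Fin n → ℕ),
      (∀ i, ∏ l, x l ^ d i l ∈ adjoinLT R x j) ∧
      LinearIndependent R (fun i => ∏ l, x l ^ d i l) ∧
      Submodule.span R (Set.range fun i => ∏ l, x l ^ d i l) =
        Subalgebra.toSubmodule (adjoinLT R x j) := by
  induction j with
  | zero =>
    refine ⟨Unit, inferInstance, fun _ _ => 0, ?_, ?_, ?_⟩
    · simp [one_mem]
    · rw [Fintype.linearIndependent_iff]
      intro g hg i
      apply FaithfulSMul.algebraMap_injective R P
      simpa [Algebra.smul_def] using hg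
    · simp [adjoinLT, Algebra.toSubmodule_bot, Submodule.one_eq_span]
  | succ j ih =>
    obtain ⟨ι, _, d, hmem, hli, hspan⟩ := ih (by omega)
    set j' : Fin n := ⟨j, hj⟩ with hj'
    let b : ι → adjoinLT R x j' := fun i => ⟨_, hmem i⟩
    have hb : LinearIndependent R b :=
      LinearIndependent.of_comp (adjoinLT R x j').val.toLinearMap hli
    have hbspan : Submodule.span R (Set.range b) = ⊤ := by
      have hinj : Function.Injective (Subalgebra.toSubmodule (adjoinLT R x j')).subtype :=
        Subtype.val_injective
      apply Submodule.map_injective_of_injective hinj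
      rw [Submodule.map_span, ← Set.range_comp, Submodule.map_top, Submodule.range_subtype]
      exact hspan
    have heq : ∀ p : ι × Fin (n - j'), ∃ e : Fin n → ℕ,
        b p.1 • x j' ^ (p.2 : ℕ) = ∏ l, x l ^ e l := fun p => by
      refine ⟨d p.1 + Pi.single j' (p.2 : ℕ), ?_⟩
      simp only [Pi.add_apply, pow_add, Finset.prod_mul_distrib]
      rw [Finset.prod_eq_single j' (f := fun l => x l ^ (Pi.single j' (p.2 : ℕ) : Fin n → ℕ) l)]
      · simp [b, Subalgebra.smul_def]
      · intro l _ hl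
        simp [hl]
      · simp
    choose e he using heq
    have hli' := linearIndependent_smul hb (hρ.linearIndependent_pow j')
    have hspan' := Submodule.span_smul_of_span_eq_top hbspan
        (Set.range fun l : Fin (n - j') => x j' ^ (l : ℕ))
    rw [hρ.span_pow] at hspan'
    have hle : adjoinLT R x j' ≤ adjoinLT R x (j + 1) := adjoinLT_mono j.le_succ
    have hx : x j' ∈ adjoinLT R x (j + 1) := mem_adjoinLT j.lt_succ_self
    refine ⟨ι × Fin (n - j'), inferInstance, e, fun p => ?_, ?_, ?_⟩
    · rw [← he]
      exact mul_mem (hle (b p.1).2) (pow_mem hx _)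
    · rw [← funext he]
      exact hli'
    · rw [show j + 1 = (j' : ℕ) + 1 from rfl, adjoinLT_succ, ← funext he]
      refine Eq.trans ?_ hspan'
      congr 1
      ext y
      simp [Set.mem_smul]

/-- If the symmetric group permutes distinct generators `x i` of the domain `P` over the fixed
ring `R`, then `P` has a finite basis over `R` that consists of monomials in the `x i`. -/
theorem exists_monomial_basis [IsDomain P] [FaithfulSMul R P]
    (hx : Algebra.adjoin R (Set.range x) = ⊤) :
    ∃ (ι : Type) (_ : Fintype ι) (d : ι → Fin n → ℕ) (b : Module.Basis ι R P),
      ∀ i, b i = ∏ l, x l ^ d i l := by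
  obtain ⟨ι, h, d, _, hli, hspan⟩ := hρ.exists_basis_adjoinLT n le_rfl
  rw [adjoinLT_self, hx, Algebra.top_toSubmodule] at hspan
  exact ⟨ι, h, d, .mk hli hspan.ge, fun i => Module.Basis.mk_apply _ _ _⟩

end PermutesGenerators

end PermutedGenerators

/-! ### Averaging a basis into a stable one -/

section StableBasis

variable {k : Type u} {R : Type v} {P : Type w} [Field k] [CommRing R] [Algebra k R]
  [AddCommGroup P] [Module k P] [Module R P] [IsScalarTower k R P] {ι : Type*} [Fintype ι]

/-- The projection of `P` onto the `k`-span of the basis `b` that applies `ε` to the coordinates. -/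
def specialize (ε : R →ₐ[k] k) (b : Module.Basis ι R P) : P →ₗ[k] P where
  toFun f := ∑ i, ε (b.repr f i) • b i
  map_add' f g := by simp [add_smul, Finset.sum_add_distrib]
  map_smul' c f := by
    have : b.repr (c • f) = c • b.repr f := by
      rw [← algebraMap_smul R c f, map_smul, algebraMap_smul]
    simp [this, Finset.smul_sum, mul_smul]

variable (ε : R →ₐ[k] k) (b : Module.Basis ι R P)

theorem specialize_apply (f : P) : specialize ε b f = ∑ i, ε (b.repr f i) • b i := rfl

theorem specialize_smul (r : R) (f : P) : specialize ε b (r • f) = ε r • specialize ε b f := by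
  simp [specialize_apply, Finset.smul_sum, mul_smul]

variable {G : Type*} [Group G] (ρ : G →* Module.End R P)

/-- `specialize` sees only classes modulo `ker ε • P`. This submodule is preserved by the `R`-linear
map `ρ g`, and `f` is congruent to its specialization. -/
theorem specialize_comp_specialize (g : G) (f : P) :
    specialize ε b (ρ g (specialize ε b f)) = specialize ε b (ρ g f) := by
  conv_rhs => rw [← b.sum_repr f]
  simp only [map_sum, map_smul, specialize_smul, specialize_apply ε b f,
    LinearMap.map_smul_of_tower]

variable [Fintype G]

/-- The average of the conjugates of `specialize ε b`. -/
def averageSpecialize : P →ₗ[k] P :=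
  (Fintype.card G : k)⁻¹ • ∑ g : G,
    ((ρ g).restrictScalars k) ∘ₗ specialize ε b ∘ₗ ((ρ g⁻¹).restrictScalars k)

theorem averageSpecialize_apply (f : P) :
    averageSpecialize ε b ρ f =
      (Fintype.card G : k)⁻¹ • ∑ g : G, ρ g (specialize ε b (ρ g⁻¹ f)) := by
  simp [averageSpecialize]

theorem map_averageSpecialize (g : G) (f : P) :
    ρ g (averageSpecialize ε b ρ f) = averageSpecialize ε b ρ (ρ g f) := by
  rw [averageSpecialize_apply, averageSpecialize_apply, LinearMap.map_smul_of_tower, map_sum,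
    ← Equiv.sum_comp (Equiv.mulLeft g) fun x => ρ x (specialize ε b (ρ x⁻¹ (ρ g f)))]
  congr 1
  refine Finset.sum_congr rfl fun x _ => ?_
  simp only [Equiv.coe_mulLeft, mul_inv_rev, map_mul, Module.End.mul_apply]
  have : ρ g⁻¹ (ρ g f) = f := by
    rw [← Module.End.mul_apply, ← map_mul, inv_mul_cancel, map_one, Module.End.one_apply]
  rw [this]

theorem averageSpecialize_specialize (f : P) :
    averageSpecialize ε b ρ (specialize ε b f) = averageSpecialize ε b ρ f := by
  simp only [averageSpecialize_apply, specialize_comp_specialize]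

/-- The image of the average is thus the `k`-span of the images of the basis; since the average
commutes with `G`, this span is stable. -/
theorem averageSpecialize_mem_span (f : P) :
    averageSpecialize ε b ρ f ∈
      Submodule.span k (Set.range fun i => averageSpecialize ε b ρ (b i)) := by
  rw [← averageSpecialize_specialize, specialize_apply, map_sum]
  refine sum_mem fun i _ => ?_
  rw [map_smul]
  exact Submodule.smul_mem _ _ (Submodule.subset_span ⟨i, rfl⟩)

/-- Let `G` act `R`-linearly on the free module `P` with the basis `b`, and let the spaces `V d`
be stable under `G`. If `b` is homogeneous and the coordinates of elements of `V d` at the basis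
elements of degree at least `d` are scalars, then `P` has a basis whose `k`-span is stable
under `G`. -/
theorem exists_stable_basis (hG : (Fintype.card G : k) ≠ 0) (V : ℕ → Submodule k P) (d : ι → ℕ)
    (hb : ∀ i, b i ∈ V (d i)) (hV : ∀ g m, ∀ f ∈ V m, ρ g f ∈ V m)
    (hcoord : ∀ m, ∀ f ∈ V m, ∀ i, m ≤ d i →
      b.repr f i = algebraMap k R (ε (b.repr f i))) :
    ∃ h : Module.Basis ι R P, ∀ g i, ρ g (h i) ∈ Submodule.span k (Set.range h) := by
  set h : ι → P := fun i => averageSpecialize ε b ρ (b i) with hh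
  have hle : (Submodule.span k (Set.range h) : Set P) ⊆ Submodule.span R (Set.range h) :=
    Submodule.span_subset_span k R _
  have hspan : ∀ m, ∀ f ∈ V m, f ∈ Submodule.span R (Set.range h) := by
    intro m
    induction m using Nat.strong_induction_on with
    | _ m ih =>
      intro f hf
      have h1 : averageSpecialize ε b ρ f ∈ Submodule.span R (Set.range h) :=
        hle (averageSpecialize_mem_span ε b ρ f)
      have h2 : f = (Fintype.card G : k)⁻¹ • ∑ g : G, ρ g (ρ g⁻¹ f) := by
        have : ∀ g : G, ρ g (ρ g⁻¹ f) = f := fun g => by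
          rw [← Module.End.mul_apply, ← map_mul, mul_inv_cancel, map_one, Module.End.one_apply]
        simp only [this, Finset.sum_const, Finset.card_univ]
        rw [← Nat.cast_smul_eq_nsmul k, smul_smul, inv_mul_cancel₀ hG, one_smul]
      -- The difference is the average of the `ρ g (y - specialize ε b y)` with `y = ρ g⁻¹ f`. By
      -- `hcoord`, only basis elements of degree below `m` contribute, and induction applies to
      -- their images.
      have h3 : f - averageSpecialize ε b ρ f ∈ Submodule.span R (Set.range h) := by
        nth_rw 1 [h2]
        rw [averageSpecialize_apply, ← smul_sub, ← Finset.sum_sub_distrib]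
        refine Submodule.smul_of_tower_mem _ _ (sum_mem fun g _ => ?_)
        rw [← map_sub]
        set y := ρ g⁻¹ f
        have hy : y ∈ V m := hV _ _ _ hf
        have hexp : y - specialize ε b y =
            ∑ i, (b.repr y i - algebraMap k R (ε (b.repr y i))) • b i := by
          simp only [sub_smul, Finset.sum_sub_distrib, b.sum_repr, algebraMap_smul]
          rfl
        rw [hexp, map_sum]
        refine sum_mem fun i _ => ?_
        rw [map_smul]
        by_cases hi : m ≤ d i
        · rw [← hcoord m y hy i hi, sub_self, zero_smul]
          exact zero_mem _
        · exact Submodule.smul_mem _ _ (ih (d i) (not_le.1 hi) _ (hV _ _ _ (hb i)))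
      simpa using add_mem h3 h1
  have hsurj : Function.Surjective (b.constr ℕ h) := by
    rw [← LinearMap.range_eq_top, Module.Basis.constr_range, eq_top_iff, ← b.span_eq,
      Submodule.span_le]
    rintro _ ⟨i, rfl⟩
    exact hspan _ _ (hb i)
  have : Module.Finite R P := .of_basis b
  -- Linear independence comes for free: a surjective endomorphism of a finite module over a
  -- commutative ring is injective.
  have hinj := OrzechProperty.injective_of_surjective_endomorphism _ hsurj
  let B := b.map (LinearEquiv.ofBijective _ ⟨hinj, hsurj⟩)
  have hB : ⇑B = h := by
    ext i
    exact b.constr_basis ℕ h i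
  refine ⟨B, fun g i => ?_⟩
  rw [hB, hh, map_averageSpecialize]
  exact averageSpecialize_mem_span ε b ρ _

end StableBasis

/-! ### Polynomials over the symmetric polynomials -/

section Symmetric

open MvPolynomial

variable (k : Type u) [Field k] (n : ℕ)

/-- The symmetric group acts on polynomials by maps linear over the symmetric polynomials. -/
def renameHom : Equiv.Perm (Fin n) →*
    (MvPolynomial (Fin n) k →ₐ[symmetricSubalgebra (Fin n) k] MvPolynomial (Fin n) k) where
  toFun e := { (rename e : MvPolynomial (Fin n) k →ₐ[k] _) with
    commutes' := fun r => r.2 e }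
  map_one' := by
    ext1 f
    exact DFunLike.congr_fun (rename_id (σ := Fin n) (R := k)) f
  map_mul' e e' := by
    ext1 f
    exact (rename_rename e' e f).symm

variable {k n}

@[simp]
theorem renameHom_apply (e : Equiv.Perm (Fin n)) (f : MvPolynomial (Fin n) k) :
    renameHom k n e f = rename e f := rfl

theorem permutesGenerators_X :
    PermutesGenerators (X : Fin n → MvPolynomial (Fin n) k) (renameHom k n) where
  apply_gen e i := by simp
  mem_of_fixed f hf := ⟨⟨f, hf⟩, rfl⟩
  gen_injective := X_injective

theorem homogeneousComponent_mul_of_isHomogeneous {r f : MvPolynomial (Fin n) k} {d m : ℕ}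
    (hf : f.IsHomogeneous d) :
    homogeneousComponent m (r * f) =
      if d ≤ m then homogeneousComponent (m - d) r * f else 0 := by
  have key : ∀ j, homogeneousComponent m (homogeneousComponent j r * f) =
      if j + d = m then homogeneousComponent j r * f else 0 := fun j =>
    (homogeneousComponent_of_mem (((homogeneousComponent_isHomogeneous j r).mul hf))).trans
      (by simp only [eq_comm])
  conv_lhs => rw [← sum_homogeneousComponent r, Finset.sum_mul, map_sum]
  simp only [key]
  split_ifs with h
  · by_cases hj : m - d < r.totalDegree + 1
    · rw [Finset.sum_eq_single (m - d)]
      · rw [if_pos (by omega)]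
      · intro j _ hj
        rw [if_neg (by omega)]
      · intro h'
        exact absurd (Finset.mem_range.2 hj) h'
    · rw [homogeneousComponent_eq_zero _ _ (by omega), zero_mul]
      refine Finset.sum_eq_zero fun j hj' => ?_
      rw [Finset.mem_range] at hj'
      rw [if_neg (by omega)]
  · exact Finset.sum_eq_zero fun j _ => if_neg (by omega)

theorem isSymmetric_homogeneousComponent {f : MvPolynomial (Fin n) k} (hf : f.IsSymmetric)
    (m : ℕ) : (homogeneousComponent m f).IsSymmetric := fun e => by
  rw [rename_homogeneousComponent, hf e]

/-- The degree `m` component of the expansion of `f` is again an expansion of `f` with symmetric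
coefficients, so uniqueness of coordinates identifies the two. -/
theorem repr_eq_of_isHomogeneous {ι : Type*} [Fintype ι]
    (b : Module.Basis ι (symmetricSubalgebra (Fin n) k) (MvPolynomial (Fin n) k)) {d : ι → ℕ}
    (hb : ∀ i, (b i).IsHomogeneous (d i)) {m : ℕ} {f : MvPolynomial (Fin n) k}
    (hf : f.IsHomogeneous m) (i : ι) :
    (b.repr f i : MvPolynomial (Fin n) k) =
      if d i ≤ m then homogeneousComponent (m - d i) (b.repr f i : MvPolynomial (Fin n) k)
      else 0 := by
  let r : ι → symmetricSubalgebra (Fin n) k := fun i =>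
    if d i ≤ m then ⟨_, isSymmetric_homogeneousComponent (b.repr f i).2 (m - d i)⟩ else 0
  have h : ∑ i, r i • b i = f := by
    have h1 := congrArg (homogeneousComponent m) (b.sum_repr f)
    rw [homogeneousComponent_eq_self hf, map_sum] at h1
    conv_rhs => rw [← h1]
    refine Finset.sum_congr rfl fun i _ => ?_
    rw [Subalgebra.smul_def, Subalgebra.smul_def, smul_eq_mul, smul_eq_mul,
      homogeneousComponent_mul_of_isHomogeneous (hb i)]
    simp only [r]
    split_ifs <;> simp
  have h2 : b.repr f i = r i := by
    conv_lhs => rw [← h]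
    rw [b.repr_sum_self]
  conv_lhs => rw [h2]
  simp only [r]
  split_ifs <;> rfl

/-- Over a field of characteristic zero the polynomial ring has a finite basis over the symmetric
polynomials whose `k`-span is stable under the symmetric group. -/
theorem exists_stable_basis_mvPolynomial [CharZero k] :
    ∃ (ι : Type) (_ : Fintype ι)
      (h : Module.Basis ι (symmetricSubalgebra (Fin n) k) (MvPolynomial (Fin n) k)),
      ∀ (e : Equiv.Perm (Fin n)) (i : ι), rename e (h i) ∈ Submodule.span k (Set.range h) := by
  have htop : Algebra.adjoin (symmetricSubalgebra (Fin n) k)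
      (Set.range (X : Fin n → MvPolynomial (Fin n) k)) = ⊤ := by
    refine eq_top_iff.2 fun f _ => ?_
    induction f using MvPolynomial.induction_on with
    | C r =>
      exact (Algebra.adjoin (symmetricSubalgebra (Fin n) k) _).algebraMap_mem
        ⟨C r, (symmetricSubalgebra (Fin n) k).algebraMap_mem r⟩
    | add f g hf hg => exact add_mem (hf trivial) (hg trivial)
    | mul_X f i hf => exact mul_mem (hf trivial) (Algebra.subset_adjoin ⟨i, rfl⟩)
  obtain ⟨ι, _, d, b, hb⟩ := permutesGenerators_X.exists_monomial_basis htop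
  have hbhom : ∀ i, (b i).IsHomogeneous (∑ l, d i l) := fun i => by
    rw [hb]
    refine IsHomogeneous.prod _ _ _ fun l _ => ?_
    exact isHomogeneous_X_pow l (d i l)
  -- Evaluation at the origin: it is the identity on scalars and kills symmetric polynomials of
  -- positive degree.
  let ε : symmetricSubalgebra (Fin n) k →ₐ[k] k :=
    (MvPolynomial.aeval 0).comp (symmetricSubalgebra (Fin n) k).val
  let ρ : Equiv.Perm (Fin n) →*
      Module.End (symmetricSubalgebra (Fin n) k) (MvPolynomial (Fin n) k) :=
    { toFun := fun e => (renameHom k n e).toLinearMap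
      map_one' := by rw [map_one]; rfl
      map_mul' := fun e e' => by rw [map_mul]; rfl }
  obtain ⟨h, hh⟩ := exists_stable_basis ε b ρ (Nat.cast_ne_zero.2 Fintype.card_ne_zero)
    (fun m => homogeneousSubmodule (Fin n) k m) _ hbhom
    (fun e m f hf => IsHomogeneous.rename_isHomogeneous hf) (fun m f hf i hi => by
      have h1 := repr_eq_of_isHomogeneous b hbhom hf i
      have h2 : ∃ c : k, (b.repr f i : MvPolynomial (Fin n) k) = C c := by
        split_ifs at h1 with h3
        · rw [show m - _ = 0 by omega, homogeneousComponent_zero] at h1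
          exact ⟨_, h1⟩
        · exact ⟨0, by simpa using h1⟩
      obtain ⟨c, hc⟩ := h2
      apply Subtype.ext
      simp [ε, hc])
  exact ⟨ι, ‹_›, h, hh⟩

end Symmetric

/-! ### From polynomials to tensor powers of `D` -/

section Model

open MvPolynomial

variable {k : Type u} {D : Type v} [Field k] [CommRing D] [Algebra k D]

/-- `D` is obtained from the polynomial algebra `k[h]` by inverting `h ^ u`. -/
structure IsPolynomialModel (k : Type u) {D : Type v} [Field k] [CommRing D] [Algebra k D]
    (h : D) (u : ℕ) : Prop where
  linearIndependent : LinearIndependent k fun j : ℕ => h ^ j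
  isUnit : IsUnit (h ^ u)
  exists_pow_mul : ∀ d : D, ∃ (N : ℕ) (F : Polynomial k), (h ^ u) ^ N * d = Polynomial.aeval h F

theorem exists_isPolynomialModel
    (hD : Nonempty (D ≃ₐ[k] Polynomial k) ∨ Nonempty (D ≃ₐ[k] LaurentPolynomial k)) :
    ∃ (h : D) (u : ℕ), IsPolynomialModel k h u := by
  have aux : ∀ (h : D) (u : ℕ), Function.Injective (Polynomial.aeval (R := k) h) →
      IsUnit (h ^ u) →
      (∀ d : D, ∃ (N : ℕ) (F : Polynomial k), (h ^ u) ^ N * d = Polynomial.aeval h F) →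
      IsPolynomialModel k h u := fun h u h1 h2 h3 => by
    refine ⟨?_, h2, h3⟩
    have := (Polynomial.basisMonomials k).linearIndependent.map' (Polynomial.aeval h).toLinearMap
      (LinearMap.ker_eq_bot.2 h1)
    have h4 : (fun j : ℕ => h ^ j) =
        (Polynomial.aeval h).toLinearMap ∘ Polynomial.basisMonomials k := by
      ext j
      simp
    rw [h4]
    exact this
  rcases hD with ⟨⟨e⟩⟩ | ⟨⟨e⟩⟩
  · have he : ∀ F : Polynomial k, Polynomial.aeval (e.symm Polynomial.X) F = e.symm F := fun F => by
      rw [← AlgEquiv.coe_toAlgHom, Polynomial.aeval_algHom_apply, Polynomial.aeval_X_left_apply]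
    -- The exponent `u = 0` means that nothing is inverted; the Laurent case below takes `u = 1`, so
    -- that both cases share one argument.
    refine ⟨e.symm Polynomial.X, 0, aux _ _ ?_ (by simp) fun d => ⟨0, e d, by simp [he]⟩⟩
    rw [show ⇑(Polynomial.aeval (R := k) (e.symm Polynomial.X)) = e.symm from funext he]
    exact e.symm.injective
  · have he : ∀ F : Polynomial k, Polynomial.aeval (e.symm (LaurentPolynomial.T 1)) F =
        e.symm (Polynomial.toLaurent F) := fun F => by
      rw [← Polynomial.toLaurentAlg_apply, ← Polynomial.toLaurent_X,
        ← Polynomial.toLaurentAlg_apply, ← AlgEquiv.coe_toAlgHom, Polynomial.aeval_algHom_apply,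
        Polynomial.aeval_algHom_apply, Polynomial.aeval_X_left_apply]
    refine ⟨e.symm (LaurentPolynomial.T 1), 1, aux _ _ ?_ ?_ fun d => ?_⟩
    · rw [show ⇑(Polynomial.aeval (R := k) (e.symm (LaurentPolynomial.T 1))) =
        e.symm ∘ Polynomial.toLaurent from funext he]
      exact e.symm.injective.comp Polynomial.toLaurent_injective
    · rw [pow_one]
      exact (LaurentPolynomial.isUnit_T 1).map e.symm
    · obtain ⟨N, F, hF⟩ := LaurentPolynomial.exists_T_pow (e d)
      refine ⟨N, F, ?_⟩
      rw [he, hF, map_mul, AlgEquiv.symm_apply_apply, pow_one, ← map_pow,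
        LaurentPolynomial.T_pow, mul_comm]
      simp

variable {n : ℕ}

theorem elemAt_eq_singleAlgHom (d : D) (i : Fin n) :
    elemAt k d i = PiTensorProduct.singleAlgHom i d := rfl

theorem prod_elemAt (x : Fin n → D) : ∏ i, elemAt k (x i) i = PiTensorProduct.tprod k x := by
  simp only [elemAt]
  rw [← PiTensorProduct.tprod_prod]
  congr 1
  ext j
  rw [Finset.prod_apply, Finset.prod_eq_single j]
  · simp
  · intro i _ hi
    simp [hi.symm]
  · simp

/-- The homomorphism `k[X_1, …, X_n] → D^n` that sends `X_i` to `1 ⊗ … ⊗ h ⊗ … ⊗ 1`. -/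
def polyToTPow (k : Type u) {D : Type v} [Field k] [CommRing D] [Algebra k D] (h : D) (n : ℕ) :
    MvPolynomial (Fin n) k →ₐ[k] TPow k D n :=
  aeval fun i => elemAt k h i

theorem polyToTPow_rename (h : D) (e : Equiv.Perm (Fin n)) (f : MvPolynomial (Fin n) k) :
    polyToTPow k h n (rename e f) = tensorPerm e (polyToTPow k h n f) := by
  have : (polyToTPow k h n).comp (rename e) = (tensorPerm e).comp (polyToTPow k h n) := by
    ext i
    simp [polyToTPow, tensorPerm_elemAt]
  exact DFunLike.congr_fun this f

theorem polyToTPow_prod_aeval (h : D) (F : Fin n → Polynomial k) :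
    polyToTPow k h n (∏ i, Polynomial.aeval (X i) (F i)) =
      PiTensorProduct.tprod k fun i => Polynomial.aeval h (F i) := by
  rw [map_prod, ← prod_elemAt]
  refine Finset.prod_congr rfl fun i _ => ?_
  rw [← Polynomial.aeval_algHom_apply, elemAt_eq_singleAlgHom, ← Polynomial.aeval_algHom_apply]
  simp [polyToTPow, elemAt_eq_singleAlgHom]

namespace IsPolynomialModel

variable {h : D} {u : ℕ} (H : IsPolynomialModel k h u)

include H in
-- Extend the powers of `h` to a basis of `D`. Distinct monomials go to distinct members of the
-- product basis of `D^n`.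
theorem polyToTPow_injective : Function.Injective (polyToTPow k h n) := by
  let b := Module.Basis.sumExtend H.linearIndependent
  have hb : ∀ j, b (Sum.inl j) = h ^ j := fun j => by
    simp only [b, Module.Basis.sumExtend, Module.Basis.reindex_apply, Module.Basis.extend_apply_self]
    rfl
  let B := Basis.piTensorProduct (R := k) fun _ : Fin n => b
  have hli : LinearIndependent k fun α : Fin n →₀ ℕ => polyToTPow k h n (monomial α 1) := by
    have h1 := B.linearIndependent.comp (fun (α : Fin n →₀ ℕ) i => Sum.inl (α i))
      fun α β hαβ => by
        ext i
        simpa using congrFun hαβ i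
    have h2 : (fun α : Fin n →₀ ℕ => polyToTPow k h n (monomial α 1)) =
        B ∘ fun (α : Fin n →₀ ℕ) i => Sum.inl (α i) := ?_
    · rw [h2]
      exact h1
    funext α
    simp only [Function.comp_apply, B, Basis.piTensorProduct_apply, hb]
    rw [monomial_eq, C_1, one_mul, Finsupp.prod_fintype _ _ (by simp)]
    have := polyToTPow_prod_aeval h (n := n) fun i => (Polynomial.X : Polynomial k) ^ α i
    simpa using this
  refine (injective_iff_map_eq_zero _).2 fun f hf => ?_
  rw [← (basisMonomials (Fin n) k).linearCombination_repr f, ← AlgHom.coe_toLinearMap,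
    Finsupp.apply_linearCombination] at hf
  have h2 := linearIndependent_iff.1 hli _ hf
  simpa using h2

/-- The symmetric polynomial that becomes invertible in `D^n`. -/
def denominator (k : Type u) [Field k] (u n : ℕ) : symmetricSubalgebra (Fin n) k :=
  ⟨∏ i, X i ^ u, fun e => by
    simpa using Equiv.prod_comp e fun i => (X i : MvPolynomial (Fin n) k) ^ u⟩

theorem polyToTPow_denominator :
    polyToTPow k h n (denominator k u n).1 = PiTensorProduct.tprod k fun _ => h ^ u := by
  have := polyToTPow_prod_aeval h (n := n) fun _ => (Polynomial.X : Polynomial k) ^ u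
  simpa [denominator] using this

include H in
theorem isUnit_denominator : IsUnit (polyToTPow k h n (denominator k u n).1) := by
  obtain ⟨y, hy⟩ := H.isUnit.exists_right_inv
  refine IsUnit.of_mul_eq_one (PiTensorProduct.tprod k fun _ => y) ?_
  rw [polyToTPow_denominator, PiTensorProduct.tprod_mul_tprod]
  have : (fun _ : Fin n => h ^ u) * (fun _ => y) = 1 := funext fun _ => hy
  rw [this]
  rfl

include H in
-- Every element has a power of the symmetric denominator that clears it. All larger exponents are
-- allowed so that finitely many elements can share one.
theorem exists_denominator_mul (d : TPow k D n) :
    ∃ N : ℕ, ∀ M ≥ N, ∃ f, polyToTPow k h n (denominator k u n).1 ^ M * d = polyToTPow k h n f := by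
  suffices hN : ∃ (N : ℕ) (f : _), polyToTPow k h n (denominator k u n).1 ^ N * d =
      polyToTPow k h n f by
    obtain ⟨N, f, hf⟩ := hN
    refine ⟨N, fun M hM => ⟨(denominator k u n).1 ^ (M - N) * f, ?_⟩⟩
    rw [map_mul, ← hf, map_pow, ← mul_assoc, ← pow_add, Nat.sub_add_cancel hM]
  induction d using PiTensorProduct.induction_on with
  | smul_tprod r x =>
    choose N F hF using fun i => H.exists_pow_mul (x i)
    -- The denominator multiplies all tensor factors at once, so factor `i` receives the surplus
    -- exponent `∑ j ≠ i, N j` beyond its own `N i`.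
    refine ⟨∑ i, N i, r • ∏ i, Polynomial.aeval (X i)
      ((Polynomial.X ^ u) ^ (∑ i ∈ Finset.univ.erase i, N i) * F i), ?_⟩
    rw [map_smul, polyToTPow_prod_aeval, polyToTPow_denominator, mul_smul_comm]
    congr 1
    rw [← PiTensorProduct.tprodMonoidHom_apply, ← PiTensorProduct.tprodMonoidHom_apply, ← map_pow,
      ← map_mul, PiTensorProduct.tprodMonoidHom_apply]
    congr 1
    ext i
    simp only [Pi.mul_apply, Pi.pow_apply, map_mul, map_pow, Polynomial.aeval_X]
    rw [← hF, ← mul_assoc, ← pow_add, Finset.sum_erase_add _ _ (Finset.mem_univ i)]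
  | add d e hd he =>
    obtain ⟨N, f, hf⟩ := hd
    obtain ⟨M, g, hg⟩ := he
    refine ⟨N + M, (denominator k u n).1 ^ M * f + (denominator k u n).1 ^ N * g, ?_⟩
    simp only [map_add, map_mul, map_pow, ← hf, ← hg]
    ring

include H in
theorem isDomain_tpow : IsDomain (TPow k D n) := by
  have hinj := H.polyToTPow_injective (n := n)
  have : Nontrivial (TPow k D n) := hinj.nontrivial
  have : NoZeroDivisors (TPow k D n) := by
    refine ⟨fun {d e} hde => ?_⟩
    obtain ⟨N, hN⟩ := H.exists_denominator_mul d
    obtain ⟨M, hM⟩ := H.exists_denominator_mul e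
    obtain ⟨f, hf⟩ := hN N le_rfl
    obtain ⟨g, hg⟩ := hM M le_rfl
    have hu := fun N => (H.isUnit_denominator (n := n)).pow N
    have hfg : polyToTPow k h n (f * g) = 0 := by
      rw [map_mul, ← hf, ← hg, mul_mul_mul_comm, hde, mul_zero]
    rw [map_eq_zero_iff _ hinj, mul_eq_zero] at hfg
    refine hfg.imp (fun h0 => ?_) fun h0 => ?_
    · rwa [h0, map_zero, (hu N).mul_right_eq_zero] at hf
    · rwa [h0, map_zero, (hu M).mul_right_eq_zero] at hg
  exact NoZeroDivisors.to_isDomain _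

include H in
-- `D^n` is a quotient of a polynomial ring in `n + 1` variables, the extra one going to the inverse
-- of the denominator.
theorem isNoetherianRing_tpow : IsNoetherianRing (TPow k D n) := by
  obtain ⟨y, hy⟩ := (H.isUnit_denominator (n := n)).exists_left_inv
  let ψ : MvPolynomial (Option (Fin n)) k →ₐ[k] TPow k D n :=
    aeval fun o => o.elim y fun i => elemAt k h i
  have hψ : ∀ f, ψ (rename some f) = polyToTPow k h n f := fun f => by
    simp [ψ, aeval_rename, polyToTPow, Function.comp_def]
  refine isNoetherianRing_of_surjective _ _ ψ.toRingHom fun d => ?_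
  obtain ⟨N, hN⟩ := H.exists_denominator_mul d
  obtain ⟨f, hf⟩ := hN N le_rfl
  refine ⟨X none ^ N * rename some f, ?_⟩
  change ψ _ = d
  rw [map_mul, hψ, ← hf, map_pow, show ψ (X none) = y by simp [ψ], ← mul_assoc, ← mul_pow, hy,
    one_pow, one_mul]

theorem polyToTPow_mem_dStar {f : MvPolynomial (Fin n) k} (hf : f.IsSymmetric) :
    polyToTPow k h n f ∈ DStar k D n := fun e => by
  change tensorPerm e _ = _
  rw [← polyToTPow_rename, hf e]

include H in
theorem isSymmetric_of_mem_dStar {f : MvPolynomial (Fin n) k}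
    (hf : polyToTPow k h n f ∈ DStar k D n) : f.IsSymmetric := fun e =>
  H.polyToTPow_injective ((polyToTPow_rename h e f).trans (hf e))

include H in
/-- `D^n` has a finite basis over `D^*` whose `k`-span is stable under the symmetric group. -/
theorem exists_stable_basis_tpow [CharZero k] :
    ∃ (ι : Type) (_ : Fintype ι) (b : Module.Basis ι (DStar k D n) (TPow k D n)),
      ∀ (e : Equiv.Perm (Fin n)) (i : ι), tensorPerm e (b i) ∈ Submodule.span k (Set.range b) := by
  obtain ⟨ι, _, b, hb⟩ := exists_stable_basis_mvPolynomial (k := k) (n := n)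
  set s := polyToTPow k h n (denominator k u n).1 with hs
  have hsmem : ∀ N, s ^ N ∈ DStar k D n :=
    fun N => pow_mem (polyToTPow_mem_dStar (denominator k u n).2) N
  have hu : ∀ N, IsUnit (s ^ N) := fun N => H.isUnit_denominator.pow N
  have hinj := H.polyToTPow_injective (n := n)
  have hli : LinearIndependent (DStar k D n) fun i => polyToTPow k h n (b i) := by
    rw [Fintype.linearIndependent_iff]
    intro g hg
    choose N hN using fun i => H.exists_denominator_mul (g i).1
    choose f hf using fun i => hN i (∑ j, N j) (Finset.single_le_sum (fun _ _ => Nat.zero_le _)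
      (Finset.mem_univ i))
    have hfsymm : ∀ i, (f i).IsSymmetric := fun i => H.isSymmetric_of_mem_dStar <| by
      rw [← hf]
      exact mul_mem (hsmem _) (g i).2
    have h0 : ∑ i, (⟨f i, hfsymm i⟩ : symmetricSubalgebra (Fin n) k) • b i = 0 := by
      apply hinj
      rw [map_zero, ← mul_zero (s ^ ∑ j, N j), ← hg, map_sum, Finset.mul_sum]
      refine Finset.sum_congr rfl fun i _ => ?_
      rw [Subalgebra.smul_def, Subalgebra.smul_def, smul_eq_mul, smul_eq_mul, map_mul, ← hf,
        mul_assoc]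
    intro i
    have hi := congrArg Subtype.val (Fintype.linearIndependent_iff.1 b.linearIndependent _ h0 i)
    have hfi := hf i
    rw [show f i = 0 from hi, map_zero, (hu _).mul_right_eq_zero] at hfi
    exact Subtype.ext hfi
  have hspan : ⊤ ≤ Submodule.span (DStar k D n) (Set.range fun i => polyToTPow k h n (b i)) := by
    intro d _
    obtain ⟨N, hN⟩ := H.exists_denominator_mul d
    obtain ⟨f, hf⟩ := hN N le_rfl
    obtain ⟨y, hy⟩ := (hu N).exists_left_inv
    -- The inverse of an invariant unit is invariant, so dividing by the denominator is a scalar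
    -- operation over `D^*`.
    have hymem : y ∈ DStar k D n := fun e => by
      change tensorPerm e y = y
      have h1 : tensorPerm e (s ^ N) = s ^ N := hsmem N e
      have h2 : tensorPerm e y * s ^ N = 1 := by rw [← h1, ← map_mul, hy, map_one]
      exact (hu N).mul_right_cancel (h2.trans hy.symm)
    have hd : d = (⟨y, hymem⟩ : DStar k D n) • polyToTPow k h n f := by
      rw [Subalgebra.smul_def, smul_eq_mul, ← hf, ← mul_assoc, hy, one_mul]
    rw [hd, ← b.sum_repr f, map_sum]
    refine Submodule.smul_mem _ _ (sum_mem fun i _ => ?_)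
    rw [Subalgebra.smul_def, smul_eq_mul, map_mul]
    exact Submodule.smul_mem _ (⟨_, polyToTPow_mem_dStar (b.repr f i).2⟩ : DStar k D n)
      (Submodule.subset_span ⟨i, rfl⟩)
  refine ⟨ι, ‹_›, .mk hli hspan, fun e i => ?_⟩
  rw [Module.Basis.coe_mk, ← polyToTPow_rename]
  have h1 := Submodule.mem_map_of_mem (f := (polyToTPow k h n).toLinearMap) (hb e i)
  rwa [Submodule.map_span, ← Set.range_comp] at h1

end IsPolynomialModel

/-- A nonzero free extension is faithfully flat, and the noetherian property of `S ⊗ R ≅ S`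
descends. -/
theorem isNoetherianRing_of_free {R : Type u} {S : Type v} [CommRing R] [CommRing S] [Algebra R S]
    [Module.Free R S] [Nontrivial S] [IsNoetherianRing S] : IsNoetherianRing R := by
  have : IsNoetherian S (TensorProduct R S R) :=
    isNoetherian_of_linearEquiv (TensorProduct.AlgebraTensorModule.rid R S S).symm
  exact Submodule.IsNoetherian.of_isNoetherian_tensorProduct_of_faithfullyFlat this

end Model

/-! ### Fixed points of maps that preserve the span of a basis -/

section Invariants

variable {k : Type u} {R : Type v} {M : Type w} [Field k] [CommRing R] [Algebra k R]
  [AddCommGroup M] [Module k M] [Module R M] [IsScalarTower k R M] {ι : Type*}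
  (b : Module.Basis ι R M)

/-- The map that applies a functional to the coordinates with respect to the basis `b`. -/
def mapCoords (l : R →ₗ[k] k) : M →ₗ[k] M :=
  Finsupp.linearCombination k b ∘ₗ Finsupp.mapRange.linearMap l ∘ₗ
    b.repr.toLinearMap.restrictScalars k

theorem mapCoords_apply (l : R →ₗ[k] k) (t : M) :
    mapCoords b l t = (b.repr t).sum fun i r => l r • b i := by
  simp [mapCoords, Finsupp.linearCombination_apply, Finsupp.sum_mapRange_index]

theorem mapCoords_smul (l : R →ₗ[k] k) (r : R) {y : M}
    (hy : y ∈ Submodule.span k (Set.range b)) : mapCoords b l (r • y) = l r • y := by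
  induction hy using Submodule.span_induction with
  | mem y hy =>
    obtain ⟨i, rfl⟩ := hy
    simp [mapCoords_apply]
  | zero => simp
  | add y z _ _ hy hz => rw [smul_add, map_add, hy, hz, smul_add]
  | smul c y _ hy => rw [smul_comm r c, map_smul, hy, smul_comm]

theorem mapCoords_mem_span (l : R →ₗ[k] k) (t : M) :
    mapCoords b l t ∈ Submodule.span k (Set.range b) := by
  rw [mapCoords_apply]
  exact sum_mem fun i _ => Submodule.smul_mem _ _ (Submodule.subset_span ⟨i, rfl⟩)

/-- With `M = R ⊗ V`, `V` being the `k`-span of `b`, the map `f` acts on `V` only and `mapCoords` on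
`R` only. -/
theorem map_mapCoords (f : M →ₗ[R] M) (hf : ∀ i, f (b i) ∈ Submodule.span k (Set.range b))
    (l : R →ₗ[k] k) (t : M) : f (mapCoords b l t) = mapCoords b l (f t) := by
  conv_rhs => rw [← b.linearCombination_repr t]
  rw [mapCoords_apply, Finsupp.linearCombination_apply, Finsupp.sum, Finsupp.sum, map_sum, map_sum,
    map_sum]
  refine Finset.sum_congr rfl fun i _ => ?_
  rw [map_smul f, mapCoords_smul b l _ (hf i), LinearMap.map_smul_of_tower]

/-- Expand the coordinates of `t` in a `k`-basis `e` of `R` and collect terms: `t` is the sum of the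
`e α` times its images under the coordinate functionals of `e`. -/
theorem mem_span_mapCoords (t : M) :
    t ∈ Submodule.span R (Set.range fun l : R →ₗ[k] k => mapCoords b l t) := by
  classical
  let e := Module.Basis.ofVectorSpace k R
  let A := (b.repr t).support.biUnion fun i => (e.repr (b.repr t i)).support
  have h : t = ∑ α ∈ A, e α • mapCoords b (e.coord α) t := by
    simp only [mapCoords_apply, Finsupp.sum, Finset.smul_sum]
    rw [Finset.sum_comm]
    conv_lhs => rw [← b.linearCombination_repr t, Finsupp.linearCombination_apply, Finsupp.sum]
    refine Finset.sum_congr rfl fun i hi => ?_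
    conv_lhs => rw [← e.linearCombination_repr (b.repr t i), Finsupp.linearCombination_apply,
      Finsupp.sum_of_support_subset (s := A) _
        (Finset.subset_biUnion_of_mem (fun i => (e.repr (b.repr t i)).support) hi) _ (by simp),
      Finset.sum_smul]
    refine Finset.sum_congr rfl fun α _ => ?_
    rw [smul_assoc, smul_comm]
    rfl
  have h' : ∑ α ∈ A, e α • mapCoords b (e.coord α) t ∈
      Submodule.span R (Set.range fun l : R →ₗ[k] k => mapCoords b l t) :=
    sum_mem fun α _ => Submodule.smul_mem _ _ (Submodule.subset_span ⟨e.coord α, rfl⟩)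
  rwa [← h] at h'

/-- If a set of `R`-linear maps preserves the `k`-span of a basis of `M`, then the `R`-module of
the elements fixed by these maps is free. -/
theorem free_of_stable_basis {G : Type*} (ρ : G → M →ₗ[R] M)
    (hρ : ∀ g i, ρ g (b i) ∈ Submodule.span k (Set.range b)) (S : Submodule R M)
    (hS : ∀ x, x ∈ S ↔ ∀ g, ρ g x = x) : Module.Free R S := by
  -- The fixed vectors in the `k`-span of `b`. A `k`-basis of this space turns out to be an
  -- `R`-basis of `S`.
  let V : Submodule k M := S.restrictScalars k ⊓ Submodule.span k (Set.range b)
  let c := Module.Basis.ofVectorSpace k V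
  let f : V →ₗ[k] S :=
    { toFun := fun y => ⟨y.1, y.2.1⟩
      map_add' := fun _ _ => rfl
      map_smul' := fun _ _ => rfl }
  let c' : _ → S := f ∘ c
  have : IsScalarTower k R S := ⟨fun c r x => Subtype.ext (smul_assoc c r x.1)⟩
  have hli : LinearIndependent R c' := by
    refine LinearIndependent.of_comp S.subtype ?_
    rw [linearIndependent_iff']
    intro s r hr j hj
    -- Functionals on `R` detect zero; applying each to the coordinates turns a relation over `R`
    -- into one over `k`.
    rw [← Module.forall_dual_apply_eq_zero_iff k]
    intro l
    have h1 := congrArg (mapCoords b l) hr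
    rw [map_sum, map_zero] at h1
    have h2 : ∑ j ∈ s, l (r j) • c j = 0 := by
      apply Subtype.ext
      rw [Submodule.coe_sum, Submodule.coe_zero, ← h1]
      exact Finset.sum_congr rfl fun j _ => (mapCoords_smul b l (r j) (c j).2.2).symm
    exact linearIndependent_iff'.1 c.linearIndependent s _ h2 j hj
  have hspan : ⊤ ≤ Submodule.span R (Set.range c') := by
    rintro ⟨t, ht⟩ -
    have hV : ∀ y (hy : y ∈ V), (⟨y, hy.1⟩ : S) ∈ Submodule.span R (Set.range c') := by
      intro y hy
      have h1 : (⟨y, hy⟩ : V) ∈ Submodule.span k (Set.range c) := by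
        rw [c.span_eq]
        trivial
      have h2 := Submodule.mem_map_of_mem (f := f) h1
      rw [Submodule.map_span, ← Set.range_comp] at h2
      exact Submodule.span_subset_span k R _ h2
    have h3 : Submodule.span R (Set.range fun l : R →ₗ[k] k => mapCoords b l t) ≤
        (Submodule.span R (Set.range c')).map S.subtype := by
      rw [Submodule.span_le]
      rintro _ ⟨l, rfl⟩
      refine ⟨_, hV _ ⟨?_, mapCoords_mem_span b l t⟩, rfl⟩
      refine (hS _).2 fun g => ?_
      rw [map_mapCoords b _ (hρ g), (hS t).1 ht g]
    obtain ⟨y, hy, hyt⟩ := h3 (mem_span_mapCoords (k := k) b t)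
    rwa [show (⟨t, ht⟩ : S) = y from Subtype.ext hyt.symm]
  exact .of_basis (.mk hli hspan)

end Invariants

/-! ### Transfer of freeness and finite generation along semilinear maps -/

section Transfer

variable {R : Type*} {Γ : Type*} {U : Type*} {T : Type*} [Ring R] [Ring Γ] [AddCommGroup U]
  [AddCommGroup T] [Module Γ U] [Module R T]

theorem free_of_addEquiv (e : R ≃+* Γ) (j : T ≃+ U) (hj : ∀ r x, j (r • x) = e r • j x)
    [Module.Free R T] : Module.Free Γ U :=
  letI := RingHomInvPair.of_ringEquiv e
  letI := RingHomInvPair.of_ringEquiv e.symm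
  .of_equiv (R := R) (M := T) (σ := (e : R →+* Γ)) { j with map_smul' := hj }

/-- A finite subset of `j '' A` spans over `R` by noetherianity. Combinations of it lift to `U`
because each scalar of `R` is matched by one of `Γ`, which may also be an opposite subalgebra. -/
theorem fg_span_of_isNoetherian (j : U →+ T) (hj : Function.Injective j)
    (hsmul : ∀ r : R, ∃ γ : Γ, ∀ x, j (γ • x) = r • j x) (F : Submodule R T) [IsNoetherian R F]
    (A : Set U) (hA : ∀ x ∈ A, j x ∈ F) : (Submodule.span Γ A).FG := by
  classical
  have hle : Submodule.span R (j '' A) ≤ F := Submodule.span_le.2 (by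
    rintro _ ⟨x, hx, rfl⟩
    exact hA x hx)
  have hfg : (Submodule.span R (j '' A)).FG := by
    have := (isNoetherian_submodule.1 ‹IsNoetherian R F›) _ hle
    exact this
  rw [Submodule.fg_span_iff_fg_span_finset_subset] at hfg
  obtain ⟨s, hs, hspan⟩ := hfg
  obtain ⟨t, htA, hts⟩ := Finset.subset_set_image_iff.1 hs
  refine ⟨t, le_antisymm (Submodule.span_mono htA) (Submodule.span_le.2 fun x hx => ?_)⟩
  have key : ∀ y ∈ Submodule.span R (s : Set T), ∃ z ∈ Submodule.span Γ (t : Set U), j z = y := by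
    intro y hy
    induction hy using Submodule.span_induction with
    | mem y hy =>
      rw [← hts] at hy
      obtain ⟨z, hz, rfl⟩ := Finset.mem_image.1 hy
      exact ⟨z, Submodule.subset_span hz, rfl⟩
    | zero => exact ⟨0, zero_mem _, map_zero j⟩
    | add y y' _ _ hy hy' =>
      obtain ⟨z, hz, rfl⟩ := hy
      obtain ⟨z', hz', rfl⟩ := hy'
      exact ⟨z + z', add_mem hz hz', map_add _ _ _⟩
    | smul r y _ hy =>
      obtain ⟨z, hz, rfl⟩ := hy
      obtain ⟨γ, hγ⟩ := hsmul r
      exact ⟨γ • z, Submodule.smul_mem _ _ hz, hγ z⟩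
  obtain ⟨z, hz, hzx⟩ := key (j x) (by
    rw [← hspan]
    exact Submodule.subset_span ⟨x, hx, rfl⟩)
  rwa [← hj hzx]

end Transfer

/-! ### Moving base elements past monomials -/

namespace GWA

variable {k : Type u} {D : Type v} {ι : Type w} [CommRing k] [CommRing D] [Algebra k D]
  (a : ι → D) (σ : ι → (D ≃ₐ[k] D))

/-- The elements that are semicentral over `D`. -/
def semicentral : Submonoid (GWA a σ) where
  carrier := {x | ∀ d : D, ∃ d' : D, x * ofBase a σ d = d' • x}
  one_mem' d := ⟨d, by rw [base_smul_def, one_mul, mul_one]⟩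
  mul_mem' {x y} hx hy d := by
    obtain ⟨d', hd'⟩ := hy d
    obtain ⟨d'', hd''⟩ := hx d'
    refine ⟨d'', ?_⟩
    rw [mul_assoc, hd', base_smul_def, ← mul_assoc, hd'', smul_mul_assoc]

theorem monomial_mem_semicentral [Fintype ι] (μ : ι → ℤ) :
    monomial a σ μ ∈ semicentral a σ :=
  Submonoid.noncommProd_mem _ _ _ _ fun i _ =>
    mul_mem (pow_mem (fun d => ⟨_, Xp_base i d⟩) _) (pow_mem (fun d => ⟨_, Xm_base i d⟩) _)

end GWA

/-! ### Freeness and quasi-centrality of the invariants over `D^*` -/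

section Main

variable {k : Type u} {D : Type v} [Field k] [CommRing D] [Algebra k D]
  (a : D) (σ : D ≃ₐ[k] D) (n m p : ℕ)

instance moduleDStar : Module (DStar k D n) (TGWA a σ n) := (DStar k D n).moduleLeft

instance : IsScalarTower k (DStar k D n) (TGWA a σ n) :=
  ⟨fun r d x => smul_assoc r d.1 x⟩

theorem groupAction_base_smul (g : ShephardTodd k m p n) (d : DStar k D n) (x : TGWA a σ n) :
    groupAction a σ n m p g (d • x) = d • groupAction a σ n m p g x := by
  have h : tensorPerm g.right d.1 = d.1 := d.2 g.right
  refine (monomialHom_base_smul a σ _ g.right d.1 x).trans ?_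
  rw [h]
  rfl

/-- The action of an element of `G(m, p, n)` as a `D^*`-linear map. -/
def groupActionLinear (g : ShephardTodd k m p n) : TGWA a σ n →ₗ[DStar k D n] TGWA a σ n where
  toFun := groupAction a σ n m p g
  map_add' := map_add _
  map_smul' := groupAction_base_smul a σ n m p g

/-- The invariants of `G(m, p, n)` as a `D^*`-submodule. -/
def invSubmodule : Submodule (DStar k D n) (TGWA a σ n) where
  carrier := Inv a σ n m p
  add_mem' := add_mem
  zero_mem' := zero_mem _
  smul_mem' d x hx g := by rw [groupAction_base_smul, hx g]

instance : Module (DStar k D n) (invSubmodule a σ n m p) := (invSubmodule a σ n m p).module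

variable {a} (ha : a ≠ 0) {h : D} {u : ℕ} (H : IsPolynomialModel k h u)

include ha H in
theorem exists_basis_monomial :
    ∃ B : Module.Basis (Fin n → ℤ) (TPow k D n) (TGWA a σ n), ∀ μ, B μ = GWA.monomial _ _ μ :=
  have := H.isDomain_tpow (n := n)
  ⟨GWA.monomialBasis (fun i j d => sigmaAt_comm σ i j d)
    (fun _ _ hij => sigmaAt_elemAt_of_ne σ hij a) (fun i => elemAt_ne_zero ha i),
    GWA.monomialBasis_apply _ _ _⟩

include ha H in
theorem ofBase_injective :
    Function.Injective (GWA.ofBase (k := k) (elemAt (n := n) k a) (sigmaAt σ)) := by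
  obtain ⟨B, hB⟩ := exists_basis_monomial σ n ha H
  intro d e hde
  have h0 : d • B 0 = e • B 0 := by
    rw [hB, GWA.monomial_zero, GWA.base_smul_def, GWA.base_smul_def, hde]
  simpa using congrArg (fun x => B.repr x 0) h0

include ha H in
theorem starHom_injective : Function.Injective (starHom a σ n m p) := fun _ _ hde =>
  Subtype.ext (ofBase_injective σ n ha H (congrArg Subtype.val hde))

include ha H in
-- The products of a stable basis of `D^n` over `D^*` with the monomials form a basis over `D^*`.
-- Its `k`-span is stable, since the group permutes monomials up to scalars in `k`.
theorem free_invSubmodule [CharZero k] :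
    Module.Free (DStar k D n) (invSubmodule a σ n m p) := by
  obtain ⟨B, hB⟩ := exists_basis_monomial σ n ha H
  obtain ⟨ι, _, b, hb⟩ := H.exists_stable_basis_tpow (n := n)
  refine free_of_stable_basis (k := k) (b.smulTower B) (groupActionLinear a σ n m p) ?_ _
    fun x => Iff.rfl
  rintro g ⟨i, μ⟩
  obtain ⟨r, hr⟩ := exists_monomialHom_monomial a σ (fun i => (g.left.1 i : kˣ)) g.right μ
  have h1 : groupActionLinear a σ n m p g (b.smulTower B (i, μ)) =
      tensorPerm g.right (b i) • r • B (μ ∘ ⇑g.right⁻¹) := by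
    rw [Module.Basis.smulTower_apply, hB, hB, ← hr]
    exact monomialHom_base_smul a σ _ g.right (b i) _
  rw [h1, smul_comm]
  refine Submodule.smul_mem _ _ ?_
  have h2 := Submodule.mem_map_of_mem
    (f := (LinearMap.toSpanSingleton (TPow k D n) _ (B (μ ∘ ⇑g.right⁻¹))).restrictScalars k)
    (hb g.right i)
  rw [Submodule.map_span, ← Set.range_comp] at h2
  refine Submodule.span_mono ?_ h2
  rintro _ ⟨j, rfl⟩
  exact ⟨(j, _), Module.Basis.smulTower_apply _ _ _⟩

include ha H in
/-- For every `x` there is a noetherian `D^*`-submodule that contains `x D^n`. -/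
theorem exists_isNoetherian_mul_mem [CharZero k] (x : TGWA a σ n) :
    ∃ F : Submodule (DStar k D n) (TGWA a σ n), IsNoetherian (DStar k D n) F ∧
      ∀ d : TPow k D n, x * GWA.ofBase _ _ d ∈ F := by
  obtain ⟨B, hB⟩ := exists_basis_monomial σ n ha H
  obtain ⟨ι, _, b, -⟩ := H.exists_stable_basis_tpow (n := n)
  have := H.isNoetherianRing_tpow (n := n)
  have := H.isDomain_tpow (n := n)
  have : Module.Free (DStar k D n) (TPow k D n) := .of_basis b
  have : Module.Finite (DStar k D n) (TPow k D n) := .of_basis b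
  have : IsNoetherianRing (DStar k D n) := isNoetherianRing_of_free (S := TPow k D n)
  -- Monomials are semicentral, so right multiplication by `D^n` introduces no monomials outside the
  -- support of `x`.
  let F := Submodule.span (TPow k D n) (B '' (B.repr x).support)
  have : Module.Finite (TPow k D n) F :=
    .span_of_finite _ ((B.repr x).support.finite_toSet.image B)
  have : Module.Finite (DStar k D n) F := .trans (TPow k D n) F
  refine ⟨F.restrictScalars _, inferInstanceAs (IsNoetherian (DStar k D n) F), fun d => ?_⟩
  rw [← B.linearCombination_repr x, Finsupp.linearCombination_apply, Finsupp.sum, Finset.sum_mul]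
  refine sum_mem fun μ hμ => ?_
  obtain ⟨d', hd'⟩ := GWA.monomial_mem_semicentral (elemAt k a) (sigmaAt σ) μ d
  rw [smul_mul_assoc, hB, hd', ← hB]
  exact F.smul_mem _ (F.smul_mem _ (Submodule.subset_span ⟨μ, hμ, rfl⟩))

/-- The isomorphism of `D^*` with its image in the invariant algebra. -/
def starEquiv (hinj : Function.Injective (starHom a σ n m p)) :
    DStar k D n ≃ₐ[k] starSubalgebra a σ n m p :=
  AlgEquiv.ofInjective _ hinj

/-- The isomorphism of `D^*` with the opposite of its image in the invariant algebra. -/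
def starEquivOp (hinj : Function.Injective (starHom a σ n m p)) :
    DStar k D n ≃+* (starSubalgebra a σ n m p).op where
  toFun d := ⟨MulOpposite.op (starHom a σ n m p d), ⟨d, rfl⟩⟩
  invFun γ := (starEquiv σ n m p hinj).symm ⟨γ.1.unop, γ.2⟩
  left_inv d := (starEquiv σ n m p hinj).symm_apply_apply d
  right_inv γ := Subtype.ext <| MulOpposite.unop_injective <|
    congrArg Subtype.val ((starEquiv σ n m p hinj).apply_symm_apply ⟨γ.1.unop, γ.2⟩)
  map_mul' d e := Subtype.ext <| MulOpposite.unop_injective <| by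
    change starHom a σ n m p (d * e) = starHom a σ n m p e * starHom a σ n m p d
    rw [mul_comm, map_mul]
  map_add' d e := Subtype.ext <| MulOpposite.unop_injective <| map_add (starHom a σ n m p) d e

/-- The anti-automorphism of the invariant algebra that exchanges `X_i⁺` and `X_i⁻`. -/
def flipInv : invSubmodule a σ n m p ≃+ Inv a σ n m p where
  toFun x := ⟨GWA.flip _ _ x.1, flip_mem_inv a σ x.2⟩
  invFun x := ⟨GWA.flip _ _ x.1, flip_mem_inv a σ x.2⟩
  left_inv x := Subtype.ext (GWA.flip_flip x.1)
  right_inv x := Subtype.ext (GWA.flip_flip x.1)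
  map_add' _ _ := Subtype.ext (map_add _ _ _)

include ha H in
theorem free_left [CharZero k] : Module.Free (starSubalgebra a σ n m p) (Inv a σ n m p) :=
  have := free_invSubmodule σ n m p ha H
  free_of_addEquiv (T := invSubmodule a σ n m p)
    (starEquiv σ n m p (starHom_injective σ n m p ha H)).toRingEquiv
    (AddEquiv.refl _) fun _ _ => rfl

include ha H in
theorem free_right [CharZero k] : Module.Free (starSubalgebra a σ n m p).op (Inv a σ n m p) :=
  have := free_invSubmodule σ n m p ha H
  free_of_addEquiv (T := invSubmodule a σ n m p)
    (starEquivOp σ n m p (starHom_injective σ n m p ha H)) (flipInv σ n m p) fun d x => by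
    apply Subtype.ext
    change GWA.flip _ _ (GWA.ofBase _ _ d.1 * x.1) = GWA.flip _ _ x.1 * GWA.ofBase _ _ d.1
    rw [GWA.flip_mul, GWA.flip_ofBase]

include ha H in
-- On the left, `x D^*` lies in a noetherian `D^*`-module. On the right, `flip` carries `D^* x` to
-- `flip x · D^*` and right scalars to left ones.
theorem isQuasiCentral_starSubalgebra [CharZero k] :
    IsQuasiCentral (starSubalgebra a σ n m p) := by
  intro x
  constructor
  · obtain ⟨F, _, hF⟩ := exists_isNoetherian_mul_mem σ n ha H x.1
    refine fg_span_of_isNoetherian (R := DStar k D n) (Inv a σ n m p).val.toAddMonoidHom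
      Subtype.val_injective (fun d => ⟨⟨_, d, rfl⟩, fun y => rfl⟩) F _ ?_
    rintro _ ⟨⟨_, d, rfl⟩, rfl⟩
    exact hF d.1
  · obtain ⟨F, _, hF⟩ := exists_isNoetherian_mul_mem σ n ha H (GWA.flip _ _ x.1)
    refine fg_span_of_isNoetherian (R := DStar k D n)
      ((GWA.flip _ _).toLinearMap.toAddMonoidHom.comp (Inv a σ n m p).val.toAddMonoidHom)
      ((GWA.flip _ _).injective.comp Subtype.val_injective)
      (fun d => ⟨⟨MulOpposite.op (starHom a σ n m p d), d, rfl⟩, fun y => ?_⟩) F _ ?_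
    · change GWA.flip _ _ (y.1 * GWA.ofBase _ _ d.1) = GWA.ofBase _ _ d.1 * GWA.flip _ _ y.1
      rw [GWA.flip_mul, GWA.flip_ofBase]
    · rintro _ ⟨⟨_, d, rfl⟩, rfl⟩
      change GWA.flip _ _ (GWA.ofBase _ _ d.1 * x.1) ∈ F
      rw [GWA.flip_mul, GWA.flip_ofBase]
      exact hF d.1

theorem isQuasiCommutative_starSubalgebra :
    IsQuasiCommutative k (starSubalgebra a σ n m p) :=
  isQuasiCommutative_of_mul_comm k _ <| by
    rintro ⟨_, d, rfl⟩ ⟨_, e, rfl⟩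
    apply Subtype.ext
    change starHom a σ n m p d * starHom a σ n m p e = starHom a σ n m p e * starHom a σ n m p d
    rw [← map_mul, mul_comm, map_mul]

end Main

end GenWeyl

end

theorem theorem7 {k : Type*} [Field k] [IsAlgClosed k] [CharZero k]
    {D : Type*} [CommRing D] [Algebra k D]
    (hD : Nonempty (D ≃ₐ[k] Polynomial k) ∨ Nonempty (D ≃ₐ[k] LaurentPolynomial k))
    (a : D) (ha : a ≠ 0) (σ : D ≃ₐ[k] D)
    (n m p : ℕ) (hm : 1 ≤ m) (hp : p ∣ m) :
    Function.Injective (GenWeyl.starHom a σ n m p) ∧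
    GenWeyl.IsHarishChandra (GenWeyl.starSubalgebra a σ n m p) ∧
    Module.Free (GenWeyl.starSubalgebra a σ n m p) (GenWeyl.Inv a σ n m p) ∧
    Module.Free (GenWeyl.starSubalgebra a σ n m p).op (GenWeyl.Inv a σ n m p) := by
  obtain ⟨h, u, H⟩ := GenWeyl.exists_isPolynomialModel hD
  exact ⟨GenWeyl.starHom_injective σ n m p ha H,
    ⟨GenWeyl.isQuasiCentral_starSubalgebra σ n m p ha H,
      GenWeyl.isQuasiCommutative_starSubalgebra σ n m p⟩,
    GenWeyl.free_left σ n m p ha H, GenWeyl.free_right σ n m p ha H⟩
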